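/- Let $d\ge 1$, $L,\beta>0$, and let $\mathcal O\subset\mathbb R^d$ be bounded with Euclidean diameter at most $S$. Consider a Bayesian contextual bandit with finite action set $\mathcal A$: the parameter $\Theta$ is drawn from a prior concentrated on $\mathcal O$; in each round $t=1,\dots,T$ a context $X_t$ is drawn from a fixed distribution $\mathbb P_X$, independently of $\Theta$ and of the past; an action $A_t\in\mathcal A$ is played; and the reward $R_t$ is drawn, given everything before, from a law depending only on $(X_t,A_t,\Theta)$. For every $\theta\in\mathcal O$ the reward law for context $x$ and action $a$ is the Laplace law restricted to $[0,L]$, that is, the probability measure on $[0,L]$ with Lebesgue density proportional to $\exp(-|r-f_\theta(x,a)|/\beta)$, where $(\theta,x,a)\mapsto f_\theta(x,a)\in\mathbb R$ is measurable. Write $R(x,a,\theta)$ for a reward drawn for context $x$, action $a$ and parameter $\theta$. Let $\psi^\star:\mathcal X\times\mathcal O\to\mathcal A$ be an optimal policy, i.e. a measurable rule that achieves the supremum $R^\star$ of $\mathbb E\big[\sum_{t=1}^T R(X_t,\psi(X_t,\Theta),\Theta)\big]$ over all measurable $\psi$. Thompson Sampling draws in round $t$ an estimate $\hat\Theta_t$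 from the posterior law of $\Theta$ given the history $\hat H^t=(X_s,\hat A_s,R_s)_{s<t}$ (conditionally on $\hat H^t$ independent of $\Theta$ and $X_t$) and plays $\hat A_t=\psi^\star(X_t,\hat\Theta_t)$. Its regret is $\mathrm{REG}^{\mathrm{TS}}=R^\star-\mathbb E\big[\sum_{t=1}^T R_t\big]$. Assume that there is a function $C:\mathcal X\times\mathcal A\to[0,\infty)$ such that each $C(X_t,\hat A_t)$ is integrable and, for every $t$, almost surely $|f_\theta(X_t,\hat A_t)-f_{\theta'}(X_t,\hat A_t)|\le C(X_t,\hat A_t)\,\|\theta-\theta'\|$ for all $\theta,\theta'\in\mathcal O$. Put $\mathbb E[C]=\frac1T\sum_{t=1}^T\mathbb E[C(X_t,\hat A_t)]$ and assume $d\beta\le 3S\,\mathbb E[C]\,T$. Then $$\mathrm{REG}^{\mathrm{TS}}\le\sqrt{\frac{L^2|\mathcal A|\,T\,d}{2}\left(1+\log\left(\frac{3S\,\mathbb E[C]\,T}{d\beta}\right)\right)}.$$ -/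

import Mathlib

open MeasureTheory ProbabilityTheory

/-- A Bayesian contextual bandit problem with parameter space `𝓞`, contexts `𝓧` and actions `𝓐`:
a prior on the parameter, a context distribution, and a reward kernel giving the law of the reward
when action `a` is played in context `x` under the parameter `θ`. -/
structure ContextualBandit (𝓞 𝓧 𝓐 : Type*) [MeasurableSpace 𝓞] [MeasurableSpace 𝓧]
    [MeasurableSpace 𝓐] where
  prior : Measure 𝓞
  context : Measure 𝓧
  reward : Kernel (𝓧 × 𝓐 × 𝓞) ℝ
  isProbabilityMeasure_prior : IsProbabilityMeasure prior
  isProbabilityMeasure_context : IsProbabilityMeasure context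
  isMarkovKernel_reward : IsMarkovKernel reward

namespace ContextualBandit

attribute [instance] isProbabilityMeasure_prior isProbabilityMeasure_context
  isMarkovKernel_reward

section

variable {𝓞 𝓧 𝓐 : Type*} [MeasurableSpace 𝓞] [MeasurableSpace 𝓧] [MeasurableSpace 𝓐]

/-- The joint law of `((X_t, Θ), R(X_t, ψ(X_t, Θ), Θ))` in one round, when the action is chosen by
the decision rule `ψ`, which knows the parameter. The context is independent of the parameter. -/
noncomputable def roundLaw (Φ : ContextualBandit 𝓞 𝓧 𝓐) (ψ : 𝓧 × 𝓞 → 𝓐) (hψ : Measurable ψ) :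
    Measure ((𝓧 × 𝓞) × ℝ) :=
  (Φ.context.prod Φ.prior) ⊗ₘ
    (Φ.reward.comap (fun p : 𝓧 × 𝓞 => (p.1, ψ p, p.2))
      (measurable_fst.prodMk (hψ.prodMk measurable_snd)))

/-- `E[∑_{t = 1}^T R(X_t, ψ(X_t, Θ), Θ)]`: every round contributes the same expectation. -/
noncomputable def cumulativeReward (Φ : ContextualBandit 𝓞 𝓧 𝓐) (T : ℕ) (ψ : 𝓧 × 𝓞 → 𝓐)
    (hψ : Measurable ψ) : ℝ :=
  ∑ _t ∈ Finset.range T, ∫ q, q.2 ∂(Φ.roundLaw ψ hψ)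

/-- The optimal cumulative reward: the supremum of `E[∑_{t = 1}^T R(X_t, ψ(X_t, Θ), Θ)]` over the
decision rules `ψ` for which this expectation is defined. -/
noncomputable def optimalCumulativeReward (Φ : ContextualBandit 𝓞 𝓧 𝓐) (T : ℕ) : ℝ :=
  sSup {v : ℝ | ∃ (ψ : 𝓧 × 𝓞 → 𝓐) (hψ : Measurable ψ),
    Integrable (fun q : (𝓧 × 𝓞) × ℝ => q.2) (Φ.roundLaw ψ hψ) ∧ v = Φ.cumulativeReward T ψ hψ}

/-- `ψ` is an optimal policy: it achieves the supremum in the optimal cumulative reward. -/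
def IsOptimalPolicy (Φ : ContextualBandit 𝓞 𝓧 𝓐) (T : ℕ) (ψ : 𝓧 × 𝓞 → 𝓐) : Prop :=
  ∃ hψ : Measurable ψ, Integrable (fun q : (𝓧 × 𝓞) × ℝ => q.2) (Φ.roundLaw ψ hψ) ∧
    Φ.cumulativeReward T ψ hψ = Φ.optimalCumulativeReward T

/-- The action `ψ(X_t, Θ̂_t)` of Thompson Sampling in round `t`. -/
def action {Ω : Type*} (ψ : 𝓧 × 𝓞 → 𝓐) (X : ℕ → Ω → 𝓧) (Θhat : ℕ → Ω → 𝓞) (t : ℕ) (ω : Ω) : 𝓐 :=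
  ψ (X t ω, Θhat t ω)

/-- The history of Thompson Sampling before round `t`: contexts, actions and rewards of the
previous rounds. Rounds are numbered from `0`. -/
def history {Ω : Type*} (ψ : 𝓧 × 𝓞 → 𝓐) (X : ℕ → Ω → 𝓧) (Θhat : ℕ → Ω → 𝓞) (R : ℕ → Ω → ℝ)
    (t : ℕ) (ω : Ω) : Fin t → 𝓧 × 𝓐 × ℝ :=
  fun s => (X s ω, action ψ X Θhat s ω, R s ω)

/-- The random variables `Θ, X_t, Θ̂_t, R_t` on `(Ω, P)` are a run over `T` rounds of Thompson
Sampling with policy `ψ` on the bandit `Φ`. -/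
structure IsThompsonSampling [StandardBorelSpace 𝓞] [Nonempty 𝓞]
    (Φ : ContextualBandit 𝓞 𝓧 𝓐) (T : ℕ) (ψ : 𝓧 × 𝓞 → 𝓐)
    {Ω : Type*} [MeasurableSpace Ω] (P : Measure Ω) [IsProbabilityMeasure P]
    (Θ : Ω → 𝓞) (X : ℕ → Ω → 𝓧) (Θhat : ℕ → Ω → 𝓞) (R : ℕ → Ω → ℝ) : Prop where
  /-- The policy is measurable. -/
  measurable_policy : Measurable ψ
  /-- The parameter is drawn from the prior. -/
  law_parameter : HasLaw Θ Φ.prior P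
  /-- The context is drawn from the context distribution, independently of the past. -/
  law_context : ∀ t < T,
    HasCondDistrib (X t) (fun ω => (Θ ω, history ψ X Θhat R t ω)) (Kernel.const _ Φ.context) P
  /-- The parameter estimate is sampled from the posterior law of `Θ` given the history; it depends
  on the parameter and the current context through the history only. -/
  law_sample : ∀ t < T,
    HasCondDistrib (Θhat t) (fun ω => (Θ ω, history ψ X Θhat R t ω, X t ω))
      ((condDistrib Θ (history ψ X Θhat R t) P).comap
        (fun p : 𝓞 × (Fin t → 𝓧 × 𝓐 × ℝ) × 𝓧 => p.2.1)
        (by fun_prop)) P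
  /-- The reward is drawn from the reward kernel at the context, the action and the parameter. -/
  law_reward : ∀ t < T,
    HasCondDistrib (R t) (fun ω => (Θ ω, history ψ X Θhat R t ω, X t ω, Θhat t ω))
      (Φ.reward.comap
        (fun p : 𝓞 × (Fin t → 𝓧 × 𝓐 × ℝ) × 𝓧 × 𝓞 => (p.2.2.1, ψ p.2.2, p.1))
        (by fun_prop)) P

/-- The Bayesian expected regret over `T` rounds of an algorithm that collects the rewards `R`. -/
noncomputable def regret (Φ : ContextualBandit 𝓞 𝓧 𝓐) (T : ℕ)
    {Ω : Type*} [MeasurableSpace Ω] (P : Measure Ω) (R : ℕ → Ω → ℝ) : ℝ :=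
  Φ.optimalCumulativeReward T - ∫ ω, ∑ t ∈ Finset.range T, R t ω ∂P

end

/-- The Laplace law with location `m` and scale `β`, for rewards bounded in `[0, L]`: the
probability measure on `[0, L]` whose Lebesgue density is proportional to `exp (-|r - m| / β)`. -/
noncomputable def boundedLaplace (L β m : ℝ) : Measure ℝ :=
  (∫⁻ r in Set.Icc 0 L, ENNReal.ofReal (Real.exp (-|r - m| / β)))⁻¹ •
    (volume.restrict (Set.Icc 0 L)).withDensity
      (fun r => ENNReal.ofReal (Real.exp (-|r - m| / β)))

/-- The bandit has a Laplace likelihood with locations `f θ x a`, scale `β` and rewards in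
`[0, L]`, for all parameters `θ` in `O`. -/
def HasLaplaceLikelihood {𝓞 𝓧 𝓐 : Type*} [MeasurableSpace 𝓞] [MeasurableSpace 𝓧]
    [MeasurableSpace 𝓐] (Φ : ContextualBandit 𝓞 𝓧 𝓐) (O : Set 𝓞) (f : 𝓞 → 𝓧 → 𝓐 → ℝ)
    (L β : ℝ) : Prop :=
  ∀ θ ∈ O, ∀ x a, Φ.reward (x, a, θ) = boundedLaplace L β (f θ x a)

/-- `E[C]` for a random variable `C = C(X, A)`: the mean of `C(X_t, A_t)` over the rounds
`t = 1, …, T`. If `E[C(X_t, A_t)]` is the same in all rounds, this is its common value. -/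
noncomputable def expectedLipschitz {𝓧 𝓐 Ω : Type*} [MeasurableSpace Ω] (P : Measure Ω) (T : ℕ)
    (C : 𝓧 → 𝓐 → ℝ) (X : ℕ → Ω → 𝓧) (A : ℕ → Ω → 𝓐) : ℝ :=
  (∑ t ∈ Finset.range T, ∫ ω, C (X t ω) (A t ω) ∂P) / T

end ContextualBandit

/-!
The regret of one round is bounded by the information that its reward carries about the parameter.
Given the history and the context, `Θ` and its estimate are independent draws from the posterior `π`,
so the regret of the round compares, for each action `a`, the mean reward of `a` under the parameters
for which `a` is optimal with its mean under the whole posterior. The second mean is that of the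
predictive law, the mixture of the reward laws over `π`. The Donsker–Varadhan inequality and
Hoeffding's lemma (`integral_mul_sub_le`) bound the difference by `l * L ^ 2 / 8` plus `l⁻¹` times a
Kullback–Leibler divergence from the predictive law; the choice `l = (s * π (ψ = a))⁻¹` and summation
over `a` give `|𝓐| * L ^ 2 / (8 * s)` plus `s` times the expected log-ratio of the likelihood of the
reward and its predictive density (`thompson_round_le`, `IsThompsonSampling.round_regret_le`).

Summed over the rounds, these log-ratios form the logarithm of one likelihood ratio
`∏ l_t(Θ) / q_t`, where `l_t(θ)` is the likelihood of the reward of round `t` and `q_t` its predictive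
density. For a fixed parameter the ratio `∏ l_t(θ) / q_t` has mean one
(`IsThompsonSampling.integral_prod_likelihood_div`), so its sum over a finite net of `N + 1`
parameters has mean `N + 1`; hence the expected logarithm of the ratio at a point of the net that may
depend on `Θ` is at most `log (N + 1)`. Moving from `Θ` to the nearest point of a net of radius `ε`
costs a divergence of two bounded Laplace laws per round, at most the distance of their locations
over `β` (`integral_log_laplaceDensity_div_le`), in total `E[C] * T * ε / β`.
A net with `N + 1 ≤ (3 * S / ε) ^ d` exists by comparing volumes (`exists_net_of_diam_le`). The radius
`ε = d * β / (E[C] * T)` and the optimal `s` give the bound.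

The densities are bounded above and away from zero, so all logarithms that occur are bounded.
-/

/-! ### The density of the bounded Laplace law -/

namespace ContextualBandit

/-- The projection of the real line onto `[0, L]`. -/
noncomputable def clip (L r : ℝ) : ℝ := max 0 (min L r)

lemma clip_mem {L : ℝ} (hL : 0 < L) (r : ℝ) : clip L r ∈ Set.Icc 0 L :=
  ⟨le_max_left _ _, max_le hL.le (min_le_left _ _)⟩

lemma clip_of_mem {L r : ℝ} (hr : r ∈ Set.Icc 0 L) : clip L r = r := by
  rw [clip, min_eq_right hr.2, max_eq_right hr.1]

lemma abs_clip_sub_clip_le (L r s : ℝ) : |clip L r - clip L s| ≤ |r - s| := by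
  unfold clip
  refine (abs_max_sub_max_le_abs (min L r) (min L s) 0 |>.trans_eq' ?_).trans ?_
  · rw [max_comm 0, max_comm 0]
  · simpa [min_comm] using abs_min_sub_min_le_max L r L s

@[fun_prop]
lemma continuous_clip (L : ℝ) : Continuous (clip L) := by
  unfold clip; fun_prop

/-- Projecting the location `m` onto `[0, L]` changes the distance to the points of `[0, L]` by a
constant only, so it does not change the bounded Laplace law. -/
lemma abs_sub_eq_clip {L r : ℝ} (hr : r ∈ Set.Icc 0 L) (m : ℝ) :
    |r - m| = |r - clip L m| + |m - clip L m| := by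
  obtain ⟨h0, h1⟩ := hr
  unfold clip
  rcases le_total m 0 with hm | hm
  · rw [min_eq_right (by linarith), max_eq_left hm, abs_of_nonneg (by linarith),
      abs_of_nonneg (by linarith), abs_of_nonpos (by linarith)]
    ring
  · rcases le_total m L with hm' | hm'
    · rw [min_eq_right hm', max_eq_right hm]; simp
    · rw [min_eq_left hm', max_eq_right (by linarith), abs_of_nonpos (by linarith),
        abs_of_nonpos (by linarith), abs_of_nonneg (by linarith)]
      ring

/-- The normalising constant of the Laplace density with location `m` and scale `β` on `[0, L]`. -/
noncomputable def laplaceMass (L β m : ℝ) : ℝ :=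
  ∫ r in Set.Icc 0 L, Real.exp (-|r - m| / β)

/-- The density of `boundedLaplace L β m` with respect to Lebesgue measure on `[0, L]`. Replacing
the location by its projection onto `[0, L]` does not change the law; projecting the argument as
well makes the density bounded above, and away from zero, on the whole line. -/
noncomputable def laplaceDensity (L β m r : ℝ) : ℝ :=
  Real.exp (-|clip L r - clip L m| / β) / laplaceMass L β (clip L m)

lemma integrableOn_exp_neg_abs (L β m : ℝ) :
    IntegrableOn (fun r => Real.exp (-|r - m| / β)) (Set.Icc 0 L) :=
  Continuous.integrableOn_Icc (by fun_prop)

lemma exp_neg_abs_mem {L β r m : ℝ} (hβ : 0 < β) (hr : r ∈ Set.Icc 0 L)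
    (hm : m ∈ Set.Icc 0 L) :
    Real.exp (-|r - m| / β) ∈ Set.Icc (Real.exp (-L / β)) 1 := by
  have h : |r - m| ≤ L := abs_le.2 ⟨by linarith [hr.1, hm.2], by linarith [hr.2, hm.1]⟩
  constructor
  · gcongr
  · rw [Real.exp_le_one_iff]
    exact div_nonpos_of_nonpos_of_nonneg (by simp) hβ.le

lemma laplaceMass_mem {L β m : ℝ} (hL : 0 < L) (hβ : 0 < β) (hm : m ∈ Set.Icc 0 L) :
    laplaceMass L β m ∈ Set.Icc (L * Real.exp (-L / β)) L := by
  have hc (c : ℝ) : ∫ _ in Set.Icc 0 L, c = L * c := by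
    simp [hL.le]
  constructor
  · rw [← hc]
    exact setIntegral_mono_on (by simp) (integrableOn_exp_neg_abs L β m) measurableSet_Icc
      fun r hr => (exp_neg_abs_mem hβ hr hm).1
  · refine (setIntegral_mono_on (integrableOn_exp_neg_abs L β m) (g := fun _ => 1) (by simp)
      measurableSet_Icc fun r hr => (exp_neg_abs_mem hβ hr hm).2).trans_eq ?_
    rw [hc, mul_one]

lemma laplaceMass_pos {L β m : ℝ} (hL : 0 < L) (hβ : 0 < β) (hm : m ∈ Set.Icc 0 L) :
    0 < laplaceMass L β m :=
  (by positivity : 0 < L * Real.exp (-L / β)).trans_le (laplaceMass_mem hL hβ hm).1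

lemma laplaceDensity_mem {L β : ℝ} (hL : 0 < L) (hβ : 0 < β) (m r : ℝ) :
    laplaceDensity L β m r ∈ Set.Icc (Real.exp (-L / β) / L) (1 / (L * Real.exp (-L / β))) := by
  have h1 := exp_neg_abs_mem hβ (clip_mem hL r) (clip_mem hL m)
  have h2 := laplaceMass_mem hL hβ (clip_mem hL m)
  have h3 := laplaceMass_pos hL hβ (clip_mem hL m)
  constructor
  · exact div_le_div₀ (Real.exp_nonneg _) h1.1 h3 h2.2
  · exact div_le_div₀ zero_le_one h1.2 (by positivity) h2.1

lemma laplaceDensity_pos {L β : ℝ} (hL : 0 < L) (hβ : 0 < β) (m r : ℝ) :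
    0 < laplaceDensity L β m r :=
  (by positivity : 0 < Real.exp (-L / β) / L).trans_le (laplaceDensity_mem hL hβ m r).1

lemma measurable_laplaceDensity (L β : ℝ) :
    Measurable fun p : ℝ × ℝ => laplaceDensity L β p.1 p.2 := by
  have h : Measurable (laplaceMass L β) := by
    refine StronglyMeasurable.measurable ?_
    exact StronglyMeasurable.integral_prod_right
      (f := fun m r => Real.exp (-|r - m| / β))
      (Continuous.stronglyMeasurable (by fun_prop))
  unfold laplaceDensity
  have := h.comp (continuous_clip L).measurable
  have h2 : Measurable (clip L) := (continuous_clip L).measurable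
  exact Measurable.div (by fun_prop) (this.comp measurable_fst)

lemma _root_.Measurable.laplaceDensity {α : Type*} [MeasurableSpace α] {L β : ℝ} {m r : α → ℝ}
    (hm : Measurable m) (hr : Measurable r) :
    Measurable fun x => laplaceDensity L β (m x) (r x) :=
  (measurable_laplaceDensity L β).comp (f := fun x => (m x, r x)) (hm.prodMk hr)

lemma measurable_laplaceDensity_right (L β m : ℝ) :
    Measurable (laplaceDensity L β m) :=
  Measurable.laplaceDensity measurable_const measurable_id

/-- The bounded Laplace law has the density `laplaceDensity` with respect to Lebesgue measure on
`[0, L]`. -/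
lemma boundedLaplace_eq_withDensity {L β : ℝ} (hL : 0 < L) (hβ : 0 < β) (m : ℝ) :
    boundedLaplace L β m = (volume.restrict (Set.Icc 0 L)).withDensity
      (fun r => ENNReal.ofReal (laplaceDensity L β m r)) := by
  have hZ := laplaceMass_pos hL hβ (clip_mem hL m)
  set c : ℝ := Real.exp (-|m - clip L m| / β) with hc
  have hc0 : 0 < c := Real.exp_pos _
  have key : ∀ r ∈ Set.Icc 0 L,
      Real.exp (-|r - m| / β) = c * Real.exp (-|r - clip L m| / β) := by
    intro r hr
    rw [hc, ← Real.exp_add, abs_sub_eq_clip hr m]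
    congr 1; ring
  have hint : ∫⁻ r in Set.Icc 0 L, ENNReal.ofReal (Real.exp (-|r - m| / β))
      = ENNReal.ofReal (c * laplaceMass L β (clip L m)) := by
    rw [← ofReal_integral_eq_lintegral_ofReal (integrableOn_exp_neg_abs L β m)
      (ae_of_all _ fun r => Real.exp_nonneg _), setIntegral_congr_fun measurableSet_Icc key,
      integral_const_mul, laplaceMass]
  rw [boundedLaplace, hint, ← withDensity_smul _ (by fun_prop)]
  refine withDensity_congr_ae ?_
  filter_upwards [ae_restrict_mem measurableSet_Icc] with r hr
  rw [Pi.smul_apply, smul_eq_mul, ← ENNReal.ofReal_inv_of_pos (by positivity),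
    ← ENNReal.ofReal_mul (by positivity), key r hr, laplaceDensity, clip_of_mem hr]
  congr 1
  field_simp

lemma integral_boundedLaplace {L β : ℝ} (hL : 0 < L) (hβ : 0 < β) (m : ℝ) (g : ℝ → ℝ) :
    ∫ r, g r ∂(boundedLaplace L β m)
      = ∫ r in Set.Icc 0 L, laplaceDensity L β m r * g r := by
  rw [boundedLaplace_eq_withDensity hL hβ, integral_withDensity_eq_integral_toReal_smul]
  · refine integral_congr_ae (ae_of_all _ fun r => ?_)
    simp [ENNReal.toReal_ofReal (laplaceDensity_pos hL hβ m r).le]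
  · exact (measurable_laplaceDensity_right L β m).ennreal_ofReal
  · simp

lemma integral_laplaceDensity {L β : ℝ} (hL : 0 < L) (hβ : 0 < β) (m : ℝ) :
    ∫ r in Set.Icc 0 L, laplaceDensity L β m r = 1 := by
  have hZ := laplaceMass_pos hL hβ (clip_mem hL m)
  have : ∀ r ∈ Set.Icc 0 L, laplaceDensity L β m r
      = Real.exp (-|r - clip L m| / β) / laplaceMass L β (clip L m) := by
    intro r hr; rw [laplaceDensity, clip_of_mem hr]
  rw [setIntegral_congr_fun measurableSet_Icc this, integral_div, ← laplaceMass, div_self hZ.ne']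

open intervalIntegral in
/-- The case `a ≤ b` of `laplaceMass_le`. On `[0, a]` the integrand on the right dominates the one
on the left; on `[a, b]` and `[b, L]` both are integrated explicitly. -/
lemma laplaceMass_le_of_le {L β a b : ℝ} (hβ : 0 < β) (ha : 0 ≤ a) (hab : a ≤ b)
    (hb : b ≤ L) :
    ∫ r in 0..L, Real.exp (-|r - b| / β) ≤
      ∫ r in 0..L, (1 + (|a - b| + |r - a| - |r - b|) / β) * Real.exp (-|r - a| / β) := by
  set G : ℝ → ℝ := fun r => (1 + (|a - b| + |r - a| - |r - b|) / β) * Real.exp (-|r - a| / β)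
    - Real.exp (-|r - b| / β) with hG
  have hGc : Continuous G := by fun_prop
  have hGi (u v : ℝ) : IntervalIntegrable G volume u v := hGc.intervalIntegrable _ _
  suffices h : 0 ≤ ∫ r in 0..L, G r by
    rw [hG, integral_sub (Continuous.intervalIntegrable (by fun_prop) _ _)
      (Continuous.intervalIntegrable (by fun_prop) _ _)] at h
    linarith
  rw [← integral_add_adjacent_intervals (hGi 0 a) (hGi a L),
    ← integral_add_adjacent_intervals (hGi a b) (hGi b L)]
  set δ := (b - a) / β with hδ
  have hδ0 : 0 ≤ δ := div_nonneg (by linarith) hβ.le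
  have h1 : 0 ≤ ∫ r in 0..a, G r := by
    refine integral_nonneg ha fun r hr => ?_
    have hr1 := hr.2
    simp only [hG]
    rw [abs_of_nonpos (by linarith : a - b ≤ 0), abs_of_nonpos (by linarith : r - a ≤ 0),
      abs_of_nonpos (by linarith : r - b ≤ 0)]
    have : Real.exp (- -(r - b) / β) ≤ Real.exp (- -(r - a) / β) := by gcongr
    calc (0 : ℝ) ≤ Real.exp (- -(r - a) / β) - Real.exp (- -(r - b) / β) := by linarith
      _ = _ := by ring
  have h2 : ∫ r in a..b, G r = β * (2 - (2 + 2 * δ) * Real.exp (-δ)) := by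
    have hF : ∀ r ∈ Set.uIcc a b, HasDerivAt (fun r => β * (-(3 + 2 * ((r - a) / β)) *
        Real.exp (-((r - a) / β)) - Real.exp ((r - b) / β))) (G r) r := by
      intro r hr
      rw [Set.uIcc_of_le hab] at hr
      have e1 : HasDerivAt (fun r : ℝ => (r - a) / β) (1 / β) r :=
        ((hasDerivAt_id r).sub_const a).div_const β
      have e2 : HasDerivAt (fun r : ℝ => (r - b) / β) (1 / β) r :=
        ((hasDerivAt_id r).sub_const b).div_const β
      have e3 := (((((e1.const_mul 2).const_add 3).neg.mul e1.neg.exp).sub e2.exp).const_mul β)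
      refine e3.congr_deriv ?_
      simp only [hG]
      rw [abs_of_nonpos (by linarith : a - b ≤ 0), abs_of_nonneg (by linarith [hr.1] : 0 ≤ r - a),
        abs_of_nonpos (by linarith [hr.2] : r - b ≤ 0), neg_neg, neg_div]
      simp only [Pi.neg_apply]
      field_simp
      ring
    rw [integral_eq_sub_of_hasDerivAt hF (hGi a b)]
    have : (a - b) / β = -δ := by rw [hδ]; ring
    simp only [this, ← hδ, sub_self, zero_div, neg_zero, Real.exp_zero]
    ring
  have h3 : ∫ r in b..L, G r
      = β * ((1 + 2 * δ - Real.exp δ) * (Real.exp (-δ) - Real.exp (-((L - a) / β)))) := by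
    have hF : ∀ r ∈ Set.uIcc b L, HasDerivAt (fun r => β * (-(1 + 2 * δ - Real.exp δ) *
        Real.exp (-((r - a) / β)))) (G r) r := by
      intro r hr
      rw [Set.uIcc_of_le hb] at hr
      have e1 : HasDerivAt (fun r : ℝ => (r - a) / β) (1 / β) r :=
        ((hasDerivAt_id r).sub_const a).div_const β
      have e3 := ((e1.neg.exp).const_mul (-(1 + 2 * δ - Real.exp δ))).const_mul β
      refine e3.congr_deriv ?_
      simp only [hG]
      rw [abs_of_nonpos (by linarith : a - b ≤ 0),
        abs_of_nonneg (by linarith [hr.1] : 0 ≤ r - a),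
        abs_of_nonneg (by linarith [hr.1] : 0 ≤ r - b)]
      have : -(r - b) / β = δ + -((r - a) / β) := by rw [hδ]; ring
      rw [this, Real.exp_add, neg_div, hδ]
      simp only [Pi.neg_apply]
      field_simp
      ring
    rw [integral_eq_sub_of_hasDerivAt hF (hGi b L)]
    rw [← hδ]
    ring
  rw [h2, h3, ← mul_add]
  refine add_nonneg h1 (mul_nonneg hβ.le ?_)
  have hE : (1 + δ) * Real.exp (-δ) ≤ 1 := by
    have := Real.add_one_le_exp δ
    calc (1 + δ) * Real.exp (-δ) ≤ Real.exp δ * Real.exp (-δ) := by gcongr; linarith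
      _ = 1 := by rw [← Real.exp_add]; simp
  have hE1 : Real.exp δ * Real.exp (-δ) = 1 := by rw [← Real.exp_add]; simp
  have hE2 : Real.exp (-((L - a) / β)) ≤ Real.exp (-δ) := by
    rw [hδ]; gcongr
  have hE3 : 0 < Real.exp (-((L - a) / β)) := Real.exp_pos _
  have hE4 : Real.exp (-δ) ≤ 1 := Real.exp_le_one_iff.2 (by linarith)
  rcases le_total (Real.exp δ) (1 + 2 * δ) with h | h
  · have := mul_nonneg (sub_nonneg.2 h) (sub_nonneg.2 hE2)
    linarith
  · have := mul_nonneg (sub_nonneg.2 h) hE3.le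
    linarith

open intervalIntegral in
/-- Moving the location of a Laplace density from `a` to `b` increases its mass on `[0, L]` at most
by a factor linear in the mean change of `|r - a| - |r - b|`. -/
lemma laplaceMass_le {L β a b : ℝ} (hL : 0 < L) (hβ : 0 < β) (ha : a ∈ Set.Icc 0 L)
    (hb : b ∈ Set.Icc 0 L) :
    laplaceMass L β b ≤ ∫ r in Set.Icc 0 L,
      (1 + (|a - b| + |r - a| - |r - b|) / β) * Real.exp (-|r - a| / β) := by
  rw [laplaceMass, integral_Icc_eq_integral_Ioc, integral_Icc_eq_integral_Ioc,
    ← integral_of_le hL.le, ← integral_of_le hL.le]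
  rcases le_total a b with h | h
  · exact laplaceMass_le_of_le hβ ha.1 h hb.2
  · -- reflect at the midpoint of `[0, L]`
    have := laplaceMass_le_of_le (L := L) (a := L - a) (b := L - b) hβ (by linarith [ha.2])
      (by linarith) (by linarith [hb.1])
    have e (x y : ℝ) : |L - x - (L - y)| = |x - y| := by
      rw [abs_sub_comm]; congr 1; ring
    have reflect (g : ℝ → ℝ) : ∫ r in 0..L, g r = ∫ r in 0..L, g (L - r) := by
      rw [integral_comp_sub_left, sub_self, sub_zero]
    rw [reflect, reflect (fun r => (1 + _) * _)] at this
    simpa only [e] using this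

lemma abs_log_div_le {c K u v : ℝ} (hc : 0 < c) (hu : u ∈ Set.Icc c K) (hv : v ∈ Set.Icc c K) :
    |Real.log (u / v)| ≤ Real.log (K / c) := by
  have hu0 := hc.trans_le hu.1
  have hv0 := hc.trans_le hv.1
  have hK0 := hu0.trans_le hu.2
  rw [Real.log_div hu0.ne' hv0.ne', Real.log_div hK0.ne' hc.ne', abs_le]
  have h1 := Real.log_le_log hc hu.1
  have h2 := Real.log_le_log hu0 hu.2
  have h3 := Real.log_le_log hc hv.1
  have h4 := Real.log_le_log hv0 hv.2
  constructor <;> linarith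

/-- The Kullback–Leibler divergence of two bounded Laplace laws, bounded by the distance of the
locations in units of the scale. -/
lemma integral_log_laplaceDensity_div_le {L β : ℝ} (hL : 0 < L) (hβ : 0 < β) (m m' : ℝ) :
    ∫ r in Set.Icc 0 L, laplaceDensity L β m r *
      Real.log (laplaceDensity L β m r / laplaceDensity L β m' r) ≤ |m - m'| / β := by
  set a := clip L m with ha
  set b := clip L m' with hb
  have hZa : 0 < laplaceMass L β a := laplaceMass_pos hL hβ (clip_mem hL m)
  have hZb : 0 < laplaceMass L β b := laplaceMass_pos hL hβ (clip_mem hL m')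
  set E : ℝ → ℝ := fun r => Real.exp (-|r - a| / β) with hE
  set g : ℝ → ℝ := fun r => (|a - b| / β + laplaceMass L β b / laplaceMass L β a) * E r
    - (1 + (|a - b| + |r - a| - |r - b|) / β) * E r with hg
  have hEi : IntegrableOn E (Set.Icc 0 L) := integrableOn_exp_neg_abs L β a
  have hui : IntegrableOn (fun r => (1 + (|a - b| + |r - a| - |r - b|) / β) * E r)
      (Set.Icc 0 L) := Continuous.integrableOn_Icc (by fun_prop)
  have hle : ∀ r ∈ Set.Icc 0 L, laplaceDensity L β m r *
      Real.log (laplaceDensity L β m r / laplaceDensity L β m' r)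
        ≤ g r / laplaceMass L β a := by
    intro r hr
    have e1 : laplaceDensity L β m r = E r / laplaceMass L β a := by
      rw [laplaceDensity, clip_of_mem hr]
    have e2 : laplaceDensity L β m' r = Real.exp (-|r - b| / β) / laplaceMass L β b := by
      rw [laplaceDensity, clip_of_mem hr]
    have e3 : laplaceDensity L β m r / laplaceDensity L β m' r
        = Real.exp ((|r - b| - |r - a|) / β) * (laplaceMass L β b / laplaceMass L β a) := by
      have : Real.exp (-|r - a| / β)
          = Real.exp ((|r - b| - |r - a|) / β) * Real.exp (-|r - b| / β) := by
        rw [← Real.exp_add]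
        congr 1
        ring
      rw [e1, e2]
      simp only [hE]
      rw [this]
      have := Real.exp_ne_zero (-|r - b| / β)
      field_simp
    have hlog := Real.log_le_sub_one_of_pos (div_pos hZb hZa)
    rw [e3, Real.log_mul (Real.exp_ne_zero _) (by positivity), Real.log_exp, e1]
    calc E r / laplaceMass L β a * ((|r - b| - |r - a|) / β
          + Real.log (laplaceMass L β b / laplaceMass L β a))
        ≤ E r / laplaceMass L β a * ((|r - b| - |r - a|) / β
          + (laplaceMass L β b / laplaceMass L β a - 1)) := by
          gcongr
      _ = _ := by simp only [hg]; field_simp; ring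
  have hgi : ∫ r in Set.Icc 0 L, g r / laplaceMass L β a ≤ |a - b| / β := by
    rw [integral_div, integral_sub (hEi.const_mul _) hui, integral_const_mul, div_le_iff₀ hZa]
    have := laplaceMass_le hL hβ (clip_mem hL m) (clip_mem hL m')
    have hEZ : ∫ r in Set.Icc 0 L, E r = laplaceMass L β a := by rw [laplaceMass]
    rw [hEZ, add_mul, div_mul_cancel₀ _ hZa.ne']
    linarith
  have hcont : IntegrableOn g (Set.Icc 0 L) := Continuous.integrableOn_Icc (by fun_prop)
  have hab : |a - b| / β ≤ |m - m'| / β :=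
    div_le_div_of_nonneg_right (abs_clip_sub_clip_le L m m') hβ.le
  suffices hi : IntegrableOn (fun r => laplaceDensity L β m r *
      Real.log (laplaceDensity L β m r / laplaceDensity L β m' r)) (Set.Icc 0 L) from
    (setIntegral_mono_on hi (hcont.div_const (laplaceMass L β a)) measurableSet_Icc hle).trans (hgi.trans hab)
  have h := measurable_laplaceDensity_right L β
  have hK := laplaceDensity_mem hL hβ
  have hc : 0 < Real.exp (-L / β) / L := by positivity
  have hmeas : Measurable fun r => laplaceDensity L β m r *
      Real.log (laplaceDensity L β m r / laplaceDensity L β m' r) :=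
    (h m).mul ((h m).div (h m')).log
  have hbd : ∀ r, ‖laplaceDensity L β m r *
      Real.log (laplaceDensity L β m r / laplaceDensity L β m' r)‖ ≤ 1 / (L * Real.exp (-L / β)) *
      Real.log (1 / (L * Real.exp (-L / β)) / (Real.exp (-L / β) / L)) := by
    intro r
    rw [norm_mul, Real.norm_eq_abs, Real.norm_eq_abs, abs_of_pos (laplaceDensity_pos hL hβ m r)]
    exact mul_le_mul (hK m r).2 (abs_log_div_le hc (hK m r) (hK m' r)) (abs_nonneg _)
      (by positivity)
  exact Integrable.of_bound hmeas.aestronglyMeasurable _ (ae_of_all _ hbd)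

end ContextualBandit

/-! ### Nets in Euclidean space -/

open Metric in
/-- The volume bound for separated sets: disjoint balls of radius `ε / 2` around the points of a
separated set lie in a ball of radius `S + ε / 2`. -/
lemma card_le_of_isSeparated_of_diam_le {d : ℕ} {S ε : ℝ} (hε : 0 < ε) (hεS : ε ≤ S)
    (s : Finset (EuclideanSpace ℝ (Fin d))) (hsep : ∀ x ∈ s, ∀ y ∈ s, x ≠ y → ε ≤ dist x y)
    (hdiam : ∀ x ∈ s, ∀ y ∈ s, dist x y ≤ S) :
    (s.card : ℝ) ≤ (3 * S / ε) ^ d := by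
  have hS : 0 < S := hε.trans_le hεS
  rcases s.eq_empty_or_nonempty with rfl | ⟨x₀, hx₀⟩
  · simp only [Finset.card_empty, Nat.cast_zero]; positivity
  set μ : Measure (EuclideanSpace ℝ (Fin d)) := volume with hμ
  have D : Set.Pairwise (s : Set (EuclideanSpace ℝ (Fin d)))
      (Function.onFun Disjoint fun c => ball c (ε / 2)) := fun c hc c' hc' hne =>
    ball_disjoint_ball (by linarith [hsep c hc c' hc' hne])
  have hsub : ⋃ c ∈ s, ball c (ε / 2) ⊆ ball x₀ (S + ε / 2) :=
    Set.iUnion₂_subset fun x hx => ball_subset_ball' (by linarith [hdiam x hx x₀ hx₀])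
  have I : (s.card : ENNReal) * ENNReal.ofReal ((ε / 2) ^ d) * μ (ball 0 1) ≤
      ENNReal.ofReal ((S + ε / 2) ^ d) * μ (ball 0 1) := by
    calc (s.card : ENNReal) * ENNReal.ofReal ((ε / 2) ^ d) * μ (ball 0 1)
        = μ (⋃ c ∈ s, ball c (ε / 2)) := by
          rw [measure_biUnion_finset D fun c _ => measurableSet_ball]
          simp only [μ.addHaar_ball_of_pos _ (half_pos hε), finrank_euclideanSpace_fin]
          simp only [Finset.sum_const, nsmul_eq_mul, mul_assoc]
      _ ≤ μ (ball x₀ (S + ε / 2)) := measure_mono hsub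
      _ = _ := by
          rw [μ.addHaar_ball_of_pos _ (by positivity : 0 < S + ε / 2), finrank_euclideanSpace_fin]
  have J := (ENNReal.mul_le_mul_iff_left (measure_ball_pos _ _ zero_lt_one).ne'
    measure_ball_lt_top.ne).1 I
  have K : (s.card : ℝ) * (ε / 2) ^ d ≤ (S + ε / 2) ^ d := by
    have := ENNReal.toReal_le_of_le_ofReal (by positivity) J
    rwa [ENNReal.toReal_mul, ENNReal.toReal_ofReal (by positivity), ENNReal.toReal_natCast] at this
  calc (s.card : ℝ) ≤ (S + ε / 2) ^ d / (ε / 2) ^ d := (le_div_iff₀ (by positivity)).2 K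
    _ = ((S + ε / 2) / (ε / 2)) ^ d := (div_pow _ _ _).symm
    _ ≤ (3 * S / ε) ^ d := by
      refine pow_le_pow_left₀ (by positivity) ?_ d
      rw [div_le_div_iff₀ (by positivity) hε]
      nlinarith

open Metric in
/-- A set of diameter at most `S` in `ℝ^d` has a net of radius `ε ≤ 3 * S` with at most
`(3 * S / ε) ^ d` points, all in the set. -/
lemma exists_net_of_diam_le {d : ℕ} {S ε : ℝ} (hε : 0 < ε) (hεS : ε ≤ 3 * S)
    {O : Set (EuclideanSpace ℝ (Fin d))} (hne : O.Nonempty) (hO : Bornology.IsBounded O)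
    (hOS : diam O ≤ S) :
    ∃ (N : ℕ) (e : ℕ → EuclideanSpace ℝ (Fin d)), (∀ k, e k ∈ O) ∧
      (∀ θ ∈ O, ∃ k ≤ N, dist (e k) θ ≤ ε) ∧ ((N : ℝ) + 1) ≤ (3 * S / ε) ^ d := by
  obtain ⟨x₀, hx₀⟩ := hne
  have hdist : ∀ x ∈ O, ∀ y ∈ O, dist x y ≤ S := fun x hx y hy =>
    (dist_le_diam_of_mem hO hx hy).trans hOS
  rcases lt_or_ge S ε with h | h
  · refine ⟨0, fun _ => x₀, fun _ => hx₀, fun θ hθ => ⟨0, le_rfl, (hdist _ hx₀ _ hθ).trans h.le⟩, ?_⟩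
    rw [Nat.cast_zero, zero_add]
    exact one_le_pow₀ ((one_le_div hε).2 hεS)
  · have hS : 0 < S := hε.trans_le h
    set ε' : NNReal := ⟨ε, hε.le⟩ with hε'
    have hcard : ∀ s : Finset (EuclideanSpace ℝ (Fin d)), (s : Set _) ⊆ O →
        IsSeparated ε' (s : Set (EuclideanSpace ℝ (Fin d))) → (s.card : ℝ) ≤ (3 * S / ε) ^ d := by
      intro s hs hsep
      refine card_le_of_isSeparated_of_diam_le hε h s (fun x hx y hy hxy => ?_)
        fun x hx y hy => hdist x (hs hx) y (hs hy)
      have : (ε' : ENNReal) < edist x y := hsep hx hy hxy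
      rw [edist_nndist, ENNReal.coe_lt_coe] at this
      exact (NNReal.coe_lt_coe.2 this).le
    have hpack : packingNumber ε' O ≠ ⊤ := by
      refine ne_top_of_le_ne_top (ENat.natCast_ne_top ⌊(3 * S / ε) ^ d⌋₊) ?_
      refine iSup_le fun C => iSup_le fun hC => iSup_le fun hsep => ?_
      by_contra! hlt
      obtain ⟨t, htC, ht⟩ := Set.exists_subset_encard_eq (Order.add_one_le_of_lt hlt)
      have htf : t.Finite := Set.finite_of_encard_eq_coe (k := ⌊(3 * S / ε) ^ d⌋₊ + 1)
        (by rw [ht]; simp)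
      have h1 := hcard htf.toFinset (by simpa using htC.trans hC) (by simpa using hsep.subset htC)
      have h2 : htf.toFinset.card = ⌊(3 * S / ε) ^ d⌋₊ + 1 := by
        rw [htf.encard_eq_coe_toFinset_card] at ht
        exact_mod_cast ht
      have h3 := Nat.lt_floor_add_one ((3 * S / ε) ^ d)
      rw [h2] at h1
      push_cast at h1
      linarith
    set A := maximalSeparatedSet ε' O with hA
    have hAf : A.Finite := by
      rw [← Set.encard_ne_top_iff, hA, encard_maximalSeparatedSet hpack]; exact hpack
    have hAO : A ⊆ O := maximalSeparatedSet_subset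
    have hcov := isCover_maximalSeparatedSet hpack
    set s := hAf.toFinset with hs
    have hcov' : ∀ θ ∈ O, ∃ c ∈ s, dist c θ ≤ ε := by
      intro θ hθ
      obtain ⟨c, hc, hcθ⟩ := hcov hθ
      refine ⟨c, by simpa [hs] using hc, ?_⟩
      have hcθ' : edist θ c ≤ ε' := hcθ
      rw [edist_nndist, ENNReal.coe_le_coe] at hcθ'
      rw [dist_comm]
      exact NNReal.coe_le_coe.2 hcθ'
    obtain ⟨c₀, hc₀, -⟩ := hcov' x₀ hx₀
    have hpos : 0 < s.card := Finset.card_pos.2 ⟨c₀, hc₀⟩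
    have hsO : ∀ x ∈ s, x ∈ O := fun x hx => hAO (by simpa [hs] using hx)
    refine ⟨s.card - 1, fun k => if h : k < s.card then (s.equivFin.symm ⟨k, h⟩ : _) else x₀,
      fun k => ?_, fun θ hθ => ?_, ?_⟩
    · dsimp only
      split_ifs with h
      · exact hsO _ (Subtype.coe_prop _)
      · exact hx₀
    · obtain ⟨c, hc, hcθ⟩ := hcov' θ hθ
      refine ⟨s.equivFin ⟨c, hc⟩, by have := (s.equivFin ⟨c, hc⟩).2; omega, ?_⟩
      simpa using hcθ
    · have := hcard s (by simpa [hs] using hAO)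
        (by simpa [hs] using isSeparated_maximalSeparatedSet)
      have h4 : ((s.card - 1 : ℕ) : ℝ) + 1 = s.card := by
        rw [Nat.cast_sub hpos]; simp
      rwa [h4]

/-! ### Mixtures and the regret of one round -/

lemma integrable_of_measurable_of_abs_le {α : Type*} [MeasurableSpace α] {μ : Measure α}
    [IsFiniteMeasure μ] {f : α → ℝ} (hf : Measurable f) {B : ℝ} (hB : ∀ x, |f x| ≤ B) :
    Integrable f μ :=
  Integrable.of_bound hf.aestronglyMeasurable B (ae_of_all _ hB)

lemma abs_integral_le_of_abs_le {α : Type*} [MeasurableSpace α] {μ : Measure α}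
    [IsProbabilityMeasure μ] {f : α → ℝ} {B : ℝ} (hB : ∀ x, |f x| ≤ B) :
    |∫ x, f x ∂μ| ≤ B := by
  simpa using norm_integral_le_of_norm_le_const (μ := μ) (f := f) (ae_of_all _ hB)

lemma integral_mem_Icc {α : Type*} [MeasurableSpace α] {μ : Measure α}
    [IsProbabilityMeasure μ] {f : α → ℝ} (hf : Measurable f) {c K : ℝ}
    (h : ∀ x, f x ∈ Set.Icc c K) : ∫ x, f x ∂μ ∈ Set.Icc c K := by
  have hi : Integrable f μ := Integrable.of_mem_Icc c K hf.aemeasurable (ae_of_all _ h)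
  constructor
  · simpa using integral_mono (integrable_const c) hi fun x => (h x).1
  · simpa using integral_mono hi (integrable_const K) fun x => (h x).2

lemma abs_le_of_mem_Icc {c K x : ℝ} (hc : 0 < c) (hx : x ∈ Set.Icc c K) : |x| ≤ K := by
  rw [abs_of_pos (hc.trans_le hx.1)]; exact hx.2

lemma abs_mul_log_div_le {c K x u v : ℝ} (hc : 0 < c) (hx : x ∈ Set.Icc c K)
    (hu : u ∈ Set.Icc c K) (hv : v ∈ Set.Icc c K) :
    |x * Real.log (u / v)| ≤ K * Real.log (K / c) := by
  rw [abs_mul]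
  exact mul_le_mul (abs_le_of_mem_Icc hc hx) (ContextualBandit.abs_log_div_le hc hu hv)
    (abs_nonneg _) (hc.le.trans (hx.1.trans hx.2))

section KL

variable {L c K : ℝ} {p q : ℝ → ℝ}

lemma integral_mul_log_div_nonneg {α : Type*} [MeasurableSpace α] {μ : Measure α}
    [IsFiniteMeasure μ] {p q : α → ℝ} (hp : Measurable p) (hq : Measurable q) (hc : 0 < c)
    (hpc : ∀ r, p r ∈ Set.Icc c K) (hqc : ∀ r, q r ∈ Set.Icc c K)
    (h : ∫ r, p r ∂μ = ∫ r, q r ∂μ) :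
    0 ≤ ∫ r, p r * Real.log (p r / q r) ∂μ := by
  have hpi : Integrable p μ :=
    integrable_of_measurable_of_abs_le hp fun r => abs_le_of_mem_Icc hc (hpc r)
  have hqi : Integrable q μ :=
    integrable_of_measurable_of_abs_le hq fun r => abs_le_of_mem_Icc hc (hqc r)
  have hi : Integrable (fun r => p r * Real.log (p r / q r)) μ :=
    integrable_of_measurable_of_abs_le (by fun_prop)
      fun r => abs_mul_log_div_le hc (hpc r) (hpc r) (hqc r)
  calc (0 : ℝ) = ∫ r, (p r - q r) ∂μ := by rw [integral_sub hpi hqi, h, sub_self]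
    _ ≤ _ := integral_mono (hpi.sub hqi) hi fun r => by
      have hp0 := hc.trans_le (hpc r).1
      have hq0 := hc.trans_le (hqc r).1
      have := Real.one_sub_inv_le_log_of_pos (div_pos hp0 hq0)
      calc p r - q r = p r * (1 - (p r / q r)⁻¹) := by field_simp
        _ ≤ _ := by gcongr

/-- The Donsker–Varadhan inequality for the identity on `[0, L]`, combined with Hoeffding's bound
for its moment generating function. -/
lemma integral_mul_sub_le (hL : 0 < L) (hp : Measurable p) (hq : Measurable q) (hc : 0 < c)
    (hpc : ∀ r, p r ∈ Set.Icc c K) (hqc : ∀ r, q r ∈ Set.Icc c K)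
    (hp1 : ∫ r in Set.Icc 0 L, p r = 1) (hq1 : ∫ r in Set.Icc 0 L, q r = 1)
    {l : ℝ} (hl : 0 < l) :
    (∫ r in Set.Icc 0 L, p r * r) - ∫ r in Set.Icc 0 L, q r * r
      ≤ l * L ^ 2 / 8 + l⁻¹ * ∫ r in Set.Icc 0 L, p r * Real.log (p r / q r) := by
  set μ : Measure ℝ := volume.restrict (Set.Icc 0 L) with hμ
  have hmem : ∀ᵐ r ∂μ, r ∈ Set.Icc 0 L := ae_restrict_mem measurableSet_Icc
  have hpi : Integrable p μ :=
    integrable_of_measurable_of_abs_le hp fun r => abs_le_of_mem_Icc hc (hpc r)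
  have hqi : Integrable q μ :=
    integrable_of_measurable_of_abs_le hq fun r => abs_le_of_mem_Icc hc (hqc r)
  have hlogi : Integrable (fun r => p r * Real.log (p r / q r)) μ :=
    integrable_of_measurable_of_abs_le (by fun_prop)
      fun r => abs_mul_log_div_le hc (hpc r) (hpc r) (hqc r)
  have hK : 0 < K := hc.trans_le ((hpc 0).1.trans (hpc 0).2)
  have hpri : Integrable (fun r => p r * r) μ := by
    refine Integrable.of_bound (hp.mul measurable_id).aestronglyMeasurable (K * L) ?_
    filter_upwards [hmem] with r hr
    rw [norm_mul, Real.norm_eq_abs, Real.norm_eq_abs, abs_of_nonneg hr.1]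
    exact mul_le_mul (abs_le_of_mem_Icc hc (hpc r)) hr.2 hr.1 hK.le
  -- the probability measure with density `q`
  set Q : Measure ℝ := μ.withDensity fun r => ENNReal.ofReal (q r) with hQ
  have hQint (g : ℝ → ℝ) : ∫ r, g r ∂Q = ∫ r, q r * g r ∂μ := by
    rw [hQ, integral_withDensity_eq_integral_toReal_smul hq.ennreal_ofReal (by simp)]
    refine integral_congr_ae (ae_of_all _ fun r => ?_)
    simp [ENNReal.toReal_ofReal (hc.le.trans (hqc r).1)]
  have hQp : IsProbabilityMeasure Q := by
    refine ⟨?_⟩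
    rw [hQ, withDensity_apply _ MeasurableSet.univ, Measure.restrict_univ,
      ← ofReal_integral_eq_lintegral_ofReal hqi (ae_of_all _ fun r => hc.le.trans (hqc r).1), hq1,
      ENNReal.ofReal_one]
  have hQmem : ∀ᵐ r ∂Q, r ∈ Set.Icc 0 L := (withDensity_absolutelyContinuous _ _).ae_le hmem
  have hmgf := (hasSubgaussianMGF_of_mem_Icc (X := id) (μ := Q) aemeasurable_id hQmem).mgf_le l
  set m : ℝ := ∫ r, q r * r ∂μ with hm
  have hQm : ∫ r, id r ∂Q = m := hQint _
  rw [mgf, hQm, hQint] at hmgf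
  set v : ℝ → ℝ := fun r => l * (r - m) - l ^ 2 * L ^ 2 / 8 with hv
  have hexp : ∫ r, q r * Real.exp (v r) ∂μ ≤ 1 := by
    have e : ∀ r, q r * Real.exp (v r)
        = q r * Real.exp (l * (id r - m)) * Real.exp (-(l ^ 2 * L ^ 2 / 8)) := by
      intro r; rw [mul_assoc, ← Real.exp_add]; rfl
    simp_rw [e]
    rw [integral_mul_const]
    calc _ ≤ Real.exp (((((‖L - 0‖₊ / 2) ^ 2 : NNReal)) : ℝ) * l ^ 2 / 2)
          * Real.exp (-(l ^ 2 * L ^ 2 / 8)) := by gcongr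
      _ = 1 := by
        rw [← Real.exp_add, Real.exp_eq_one_iff]
        push_cast
        rw [sub_zero, Real.norm_eq_abs, div_pow, sq_abs]
        ring
  have hvi : Integrable (fun r => q r * Real.exp (v r)) μ := by
    refine Integrable.of_bound (by fun_prop) (K * Real.exp (l * (L + |m|))) ?_
    filter_upwards [hmem] with r hr
    rw [norm_mul, Real.norm_eq_abs, Real.norm_eq_abs, Real.abs_exp]
    refine mul_le_mul (abs_le_of_mem_Icc hc (hqc r)) ?_ (Real.exp_nonneg _) hK.le
    gcongr
    have h1 : r - m ≤ L + |m| := by linarith [hr.2, neg_abs_le m]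
    have h2 := mul_le_mul_of_nonneg_left h1 hl.le
    have h3 : 0 ≤ l ^ 2 * L ^ 2 / 8 := by positivity
    simp only [hv]; linarith
  have hpv : Integrable (fun r => p r * v r) μ := by
    have : (fun r => p r * v r) = fun r => l * (p r * r) - (l * m + l ^ 2 * L ^ 2 / 8) * p r := by
      funext r; simp only [hv]; ring
    rw [this]
    exact (hpri.const_mul _).sub (hpi.const_mul _)
  -- Young's inequality `u * v ≤ u * log u - u + exp v` at `u = p / q`
  have hpt : ∀ r, p r * v r ≤ p r * Real.log (p r / q r) - p r + q r * Real.exp (v r) := by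
    intro r
    have hp0 := hc.trans_le (hpc r).1
    have hq0 := hc.trans_le (hqc r).1
    have h := Real.add_one_le_exp (v r - Real.log (p r / q r))
    rw [Real.exp_sub, Real.exp_log (div_pos hp0 hq0)] at h
    have h2 := mul_le_mul_of_nonneg_left h hp0.le
    have h3 : p r * (Real.exp (v r) / (p r / q r)) = q r * Real.exp (v r) := by field_simp
    rw [h3] at h2
    linarith
  have hint := integral_mono hpv ((hlogi.sub hpi).add hvi) hpt
  simp only [Pi.sub_apply, Pi.add_apply] at hint
  rw [integral_add (f := fun r => p r * Real.log (p r / q r) - p r) (hlogi.sub hpi) hvi,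
    integral_sub hlogi hpi, hp1] at hint
  have hpv' : ∫ r, p r * v r ∂μ = l * (∫ r, p r * r ∂μ) - (l * m + l ^ 2 * L ^ 2 / 8) := by
    have : (fun r => p r * v r) = fun r => l * (p r * r) - (l * m + l ^ 2 * L ^ 2 / 8) * p r := by
      funext r; simp only [hv]; ring
    rw [this, integral_sub (hpri.const_mul _) (hpi.const_mul _), integral_const_mul,
      integral_const_mul, hp1, mul_one]
  rw [hpv'] at hint
  have hfin : l * ((∫ r, p r * r ∂μ) - m)
      ≤ l * (l * L ^ 2 / 8 + l⁻¹ * ∫ r, p r * Real.log (p r / q r) ∂μ) := by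
    rw [mul_add, mul_inv_cancel_left₀ hl.ne']
    linarith
  exact le_of_mul_le_mul_left hfin hl

end KL

section Mixture

variable {E 𝓐 : Type*} [MeasurableSpace E] [Fintype 𝓐] [MeasurableSpace 𝓐]
  [DiscreteMeasurableSpace 𝓐]

lemma integral_comp_eq_sum (π : Measure E) [IsFiniteMeasure π] {ψ : E → 𝓐} (hψ : Measurable ψ)
    (g : 𝓐 → ℝ) : ∫ θ, g (ψ θ) ∂π = ∑ a, π.real (ψ ⁻¹' {a}) * g a := by
  rw [← integral_map hψ.aemeasurable (Measurable.of_discrete.aestronglyMeasurable),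
    integral_fintype (by exact Integrable.of_finite)]
  refine Finset.sum_congr rfl fun a _ => ?_
  rw [smul_eq_mul, measureReal_def, measureReal_def, Measure.map_apply hψ (measurableSet_singleton a)]

lemma integral_eq_sum_preimage (π : Measure E) {ψ : E → 𝓐}
    (hψ : Measurable ψ) (g : 𝓐 → E → ℝ) (hg : ∀ a, Integrable (g a) π) :
    ∫ θ, g (ψ θ) θ ∂π = ∑ a, ∫ θ in ψ ⁻¹' {a}, g a θ ∂π := by
  classical
  have hms (a : 𝓐) : MeasurableSet (ψ ⁻¹' {a}) := hψ (measurableSet_singleton a)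
  have h : ∀ θ, g (ψ θ) θ = ∑ a, (ψ ⁻¹' {a}).indicator (g a) θ := by
    intro θ
    rw [Finset.sum_eq_single (ψ θ)]
    · simp
    · intro a _ ha
      exact Set.indicator_of_notMem (by simpa using ha.symm) _
    · simp
  simp_rw [h]
  rw [integral_finsetSum _ fun a _ => (hg a).indicator (hms a)]
  simp_rw [integral_indicator (hms _)]

variable {L c K : ℝ} {p : 𝓐 → E → ℝ → ℝ}

/-- One round of Thompson Sampling. Here `π` is the posterior, `p a θ` the density of the reward of
the action `a` under the parameter `θ`, and the optimal action `ψ θ` is compared with an independent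
copy `ψ θ'`. The integral on the right is the information that the reward of this round carries
about the parameter. The change of measure for the action `a` is made with the weight
`(s * π (ψ = a))⁻¹`, so that each action contributes at most `L ^ 2 / (8 * s)`. -/
lemma thompson_round_le (hL : 0 < L) (hc : 0 < c) (π : Measure E) [IsProbabilityMeasure π]
    {ψ : E → 𝓐} (hψ : Measurable ψ)
    (hp : ∀ a, Measurable fun z : E × ℝ => p a z.1 z.2) (hpc : ∀ a θ r, p a θ r ∈ Set.Icc c K)
    (hp1 : ∀ a θ, ∫ r in Set.Icc 0 L, p a θ r = 1) {s : ℝ} (hs : 0 < s) :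
    (∫ θ, (∫ r in Set.Icc 0 L, p (ψ θ) θ r * r) ∂π)
        - ∫ θ', ∫ θ, (∫ r in Set.Icc 0 L, p (ψ θ') θ r * r) ∂π ∂π
      ≤ Fintype.card 𝓐 * L ^ 2 / (8 * s)
        + s * ∫ θ', ∫ θ, (∫ r in Set.Icc 0 L, p (ψ θ') θ r *
          Real.log (p (ψ θ') θ r / ∫ η, p (ψ θ') η r ∂π)) ∂π ∂π := by
  set μ : Measure ℝ := volume.restrict (Set.Icc 0 L) with hμ
  have hmem : ∀ᵐ r ∂μ, r ∈ Set.Icc 0 L := ae_restrict_mem measurableSet_Icc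
  have hK : 0 < K := by
    obtain ⟨θ⟩ : Nonempty E := π.nonempty_of_neZero
    exact hc.trans_le ((hpc (ψ θ) θ 0).1.trans (hpc (ψ θ) θ 0).2)
  have hpl (a : 𝓐) (r : ℝ) : Measurable fun θ => p a θ r :=
    (hp a).comp (measurable_id.prodMk measurable_const)
  have hpr (a : 𝓐) (θ : E) : Measurable fun r => p a θ r :=
    (hp a).comp (measurable_const.prodMk measurable_id)
  set q : 𝓐 → ℝ → ℝ := fun a r => ∫ η, p a η r ∂π with hq
  have hqm (a : 𝓐) : Measurable (q a) := by
    have := (hp a).stronglyMeasurable.integral_prod_left' (μ := π)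
    exact this.measurable
  have hqc (a : 𝓐) (r : ℝ) : q a r ∈ Set.Icc c K := integral_mem_Icc (hpl a r) fun θ => hpc a θ r
  -- the mean reward and the divergence from the mixture
  set ρ : 𝓐 → E → ℝ := fun a θ => ∫ r, p a θ r * r ∂μ with hρ
  set D : 𝓐 → E → ℝ := fun a θ => ∫ r, p a θ r * Real.log (p a θ r / q a r) ∂μ with hD
  have hpi2 (a : 𝓐) : Integrable (fun z : E × ℝ => p a z.1 z.2) (π.prod μ) :=
    integrable_of_measurable_of_abs_le (hp a) fun z => abs_le_of_mem_Icc hc (hpc a z.1 z.2)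
  have hpri2 (a : 𝓐) : Integrable (fun z : E × ℝ => p a z.1 z.2 * z.2) (π.prod μ) := by
    have hm2 : Measurable fun z : E × ℝ => p a z.1 z.2 * z.2 := (hp a).mul measurable_snd
    refine Integrable.of_bound hm2.aestronglyMeasurable (K * L) ?_
    have : ∀ᵐ z ∂(π.prod μ), z.2 ∈ Set.Icc 0 L := Measure.quasiMeasurePreserving_snd.ae hmem
    filter_upwards [this] with z hz
    rw [norm_mul, Real.norm_eq_abs, Real.norm_eq_abs, abs_of_nonneg hz.1]
    exact mul_le_mul (abs_le_of_mem_Icc hc (hpc a z.1 z.2)) hz.2 hz.1 hK.le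
  have hDi2 (a : 𝓐) : Integrable (fun z : E × ℝ =>
      p a z.1 z.2 * Real.log (p a z.1 z.2 / q a z.2)) (π.prod μ) := by
    have h1 := hp a
    have h2 : Measurable fun z : E × ℝ => q a z.2 := (hqm a).comp measurable_snd
    exact integrable_of_measurable_of_abs_le (h1.mul (h1.div h2).log)
      fun z => abs_mul_log_div_le hc (hpc a z.1 z.2) (hpc a z.1 z.2) (hqc a z.2)
  have hρi (a : 𝓐) : Integrable (ρ a) π := (hpri2 a).integral_prod_left
  have hDi (a : 𝓐) : Integrable (D a) π := (hDi2 a).integral_prod_left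
  have hq1 (a : 𝓐) : ∫ r, q a r ∂μ = 1 := by
    have := integral_integral_swap (μ := π) (ν := μ) (f := fun θ r => p a θ r) (hpi2 a)
    rw [← this]
    simp [hp1]
  have hρq (a : 𝓐) : ∫ θ, ρ a θ ∂π = ∫ r, q a r * r ∂μ := by
    have := integral_integral_swap (μ := π) (ν := μ) (f := fun θ r => p a θ r * r) (hpri2 a)
    simp only [integral_mul_const] at this
    exact this
  have hD0 (a : 𝓐) (θ : E) : 0 ≤ D a θ :=
    integral_mul_log_div_nonneg (hpr a θ) (hqm a) hc (hpc a θ) (hqc a) (by rw [hq1, hp1])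
  have e1 : ∫ θ, ρ (ψ θ) θ ∂π = ∑ a, ∫ θ in ψ ⁻¹' {a}, ρ a θ ∂π :=
    integral_eq_sum_preimage π hψ ρ hρi
  have e2 : ∫ θ', ∫ θ, ρ (ψ θ') θ ∂π ∂π = ∑ a, π.real (ψ ⁻¹' {a}) * ∫ θ, ρ a θ ∂π :=
    integral_comp_eq_sum π hψ fun a => ∫ θ, ρ a θ ∂π
  have e3 : ∫ θ', ∫ θ, D (ψ θ') θ ∂π ∂π = ∑ a, π.real (ψ ⁻¹' {a}) * ∫ θ, D a θ ∂π :=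
    integral_comp_eq_sum π hψ fun a => ∫ θ, D a θ ∂π
  change (∫ θ, ρ (ψ θ) θ ∂π) - ∫ θ', ∫ θ, ρ (ψ θ') θ ∂π ∂π
    ≤ Fintype.card 𝓐 * L ^ 2 / (8 * s) + s * ∫ θ', ∫ θ, D (ψ θ') θ ∂π ∂π
  have e4 : (Fintype.card 𝓐 : ℝ) * L ^ 2 / (8 * s) = ∑ _a : 𝓐, L ^ 2 / (8 * s) := by
    rw [Finset.sum_const, Finset.card_univ, nsmul_eq_mul, mul_div_assoc]
  rw [e1, e2, e3, e4, Finset.mul_sum, ← Finset.sum_sub_distrib, ← Finset.sum_add_distrib]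
  refine Finset.sum_le_sum fun a _ => ?_
  set J : ℝ := π.real (ψ ⁻¹' {a}) with hJ
  have hint0 : 0 ≤ ∫ θ, D a θ ∂π := integral_nonneg (hD0 a)
  rcases (measureReal_nonneg : 0 ≤ π.real (ψ ⁻¹' {a})).eq_or_lt with h0 | h0
  · have hz : π (ψ ⁻¹' {a}) = 0 := (measureReal_eq_zero_iff).1 h0.symm
    rw [Measure.restrict_eq_zero.2 hz, hJ, ← h0]
    simp only [integral_zero_measure, zero_mul, mul_zero, sub_zero, add_zero]
    positivity
  · rw [← hJ] at h0
    have hl : 0 < (s * J)⁻¹ := by positivity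
    have hpt : ∀ θ, ρ a θ ≤ ((∫ r, q a r * r ∂μ) + (s * J)⁻¹ * L ^ 2 / 8) + s * J * D a θ := by
      intro θ
      have := integral_mul_sub_le hL (hpr a θ) (hqm a) hc (hpc a θ) (hqc a) (hp1 a θ) (hq1 a) hl
      rw [inv_inv] at this
      simp only [hρ, hD]
      linarith
    have hset := integral_mono ((hρi a).integrableOn (s := ψ ⁻¹' {a}))
      (((integrable_const _).add ((hDi a).const_mul (s * J))).integrableOn) hpt
    simp only [Pi.add_apply] at hset
    rw [integral_add (integrable_const _) ((hDi a).const_mul _).integrableOn, integral_const,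
      integral_const_mul, smul_eq_mul, measureReal_restrict_apply_univ, ← hJ] at hset
    have hsub : ∫ θ in ψ ⁻¹' {a}, D a θ ∂π ≤ ∫ θ, D a θ ∂π :=
      setIntegral_le_integral (hDi a) (ae_of_all _ (hD0 a))
    have hsub' := mul_le_mul_of_nonneg_left hsub (by positivity : 0 ≤ s * J)
    have hJs : J * ((s * J)⁻¹ * L ^ 2 / 8) = L ^ 2 / (8 * s) := by field_simp
    rw [hρq]
    rw [mul_add, hJs] at hset
    linarith

end Mixture

/-! ### Conditional laws along a run of Thompson Sampling -/

/-- The tower property for a conditional distribution. -/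
lemma ProbabilityTheory.HasCondDistrib.integral_comp {Ω α γ : Type*} [MeasurableSpace Ω] [MeasurableSpace α]
    [MeasurableSpace γ] {P : Measure Ω} [IsProbabilityMeasure P] {Y : Ω → γ} {X : Ω → α}
    {κ : Kernel α γ} [IsMarkovKernel κ] (h : HasCondDistrib Y X κ P) {F : α → γ → ℝ}
    (hF : Measurable fun z : α × γ => F z.1 z.2) {B : ℝ} (hB : ∀ x y, |F x y| ≤ B) :
    ∫ ω, F (X ω) (Y ω) ∂P = ∫ ω, ∫ y, F (X ω) y ∂(κ (X ω)) ∂P := by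
  have hX : AEMeasurable X P := h.aemeasurable_fst
  have : IsProbabilityMeasure (P.map X) := Measure.isProbabilityMeasure_map hX
  have hi : Integrable (fun z : α × γ => F z.1 z.2) ((P.map X) ⊗ₘ κ) :=
    integrable_of_measurable_of_abs_le hF fun z => hB z.1 z.2
  calc ∫ ω, F (X ω) (Y ω) ∂P
      = ∫ z, F z.1 z.2 ∂(P.map fun ω => (X ω, Y ω)) :=
        (integral_map h.aemeasurable hF.aestronglyMeasurable).symm
    _ = ∫ x, ∫ y, F x y ∂(κ x) ∂(P.map X) := by
        rw [h.map_eq, Measure.integral_compProd hi]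
    _ = _ := integral_map hX hF.stronglyMeasurable.integral_kernel_prod_right'.aestronglyMeasurable

lemma integral_integral_integral_rotate {α γ δ : Type*} [MeasurableSpace α] [MeasurableSpace γ]
    [MeasurableSpace δ] {μ : Measure α} {ν : Measure γ} {ξ : Measure δ} [IsProbabilityMeasure μ]
    [IsProbabilityMeasure ν] [IsProbabilityMeasure ξ] {F : α → γ → δ → ℝ}
    (hF : Measurable fun z : α × γ × δ => F z.1 z.2.1 z.2.2) {B : ℝ}
    (hB : ∀ a b c, |F a b c| ≤ B) :
    ∫ a, ∫ b, ∫ c, F a b c ∂ξ ∂ν ∂μ = ∫ b, ∫ c, ∫ a, F a b c ∂μ ∂ξ ∂ν := by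
  have hi : Integrable (fun z : α × γ × δ => F z.1 z.2.1 z.2.2) (μ.prod (ν.prod ξ)) :=
    integrable_of_measurable_of_abs_le hF fun z => hB _ _ _
  have e1 (a : α) : ∫ b, ∫ c, F a b c ∂ξ ∂ν = ∫ z, F a z.1 z.2 ∂(ν.prod ξ) := by
    rw [integral_prod]
    exact integrable_of_measurable_of_abs_le (hF.comp (measurable_const.prodMk measurable_id))
      fun z => hB _ _ _
  simp_rw [e1]
  rw [integral_integral_swap (f := fun a (z : γ × δ) => F a z.1 z.2) hi, integral_prod]
  exact hi.integral_prod_right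

lemma measurable_integral_integral_kernel {𝓗 𝓧 𝓞 : Type*} [MeasurableSpace 𝓗] [MeasurableSpace 𝓧]
    [MeasurableSpace 𝓞] (π : Kernel 𝓗 𝓞) [IsMarkovKernel π] {F : 𝓞 → 𝓗 → 𝓧 → 𝓞 → ℝ}
    (hF : Measurable fun z : 𝓞 × 𝓗 × 𝓧 × 𝓞 => F z.1 z.2.1 z.2.2.1 z.2.2.2) :
    Measurable fun z : 𝓗 × 𝓧 => ∫ θ', ∫ θ, F θ z.1 z.2 θ' ∂(π z.1) ∂(π z.1) := by
  have m3 : Measurable fun z : (𝓗 × 𝓧) × 𝓞 =>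
      ∫ θ, F θ z.1.1 z.1.2 z.2 ∂(π z.1.1) := by
    have := StronglyMeasurable.integral_kernel_prod_right'
      (κ := π.comap (fun z : (𝓗 × 𝓧) × 𝓞 => z.1.1) (by fun_prop))
      (f := fun w : ((𝓗 × 𝓧) × 𝓞) × 𝓞 => F w.2 w.1.1.1 w.1.1.2 w.1.2)
      (hF.comp (f := fun w : ((𝓗 × 𝓧) × 𝓞) × 𝓞 =>
        (w.2, w.1.1.1, w.1.1.2, w.1.2)) (by fun_prop)).stronglyMeasurable
    exact this.measurable
  have := StronglyMeasurable.integral_kernel_prod_right'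
    (κ := π.comap (fun z : 𝓗 × 𝓧 => z.1) (by fun_prop)) m3.stronglyMeasurable
  exact this.measurable

namespace ContextualBandit

section Tower

variable {𝓞 𝓧 𝓐 Ω : Type*} [MeasurableSpace 𝓞] [MeasurableSpace 𝓧] [MeasurableSpace 𝓐]
  [StandardBorelSpace 𝓞] [Nonempty 𝓞] [MeasurableSpace Ω]
  {Φ : ContextualBandit 𝓞 𝓧 𝓐} {T : ℕ} {ψ : 𝓧 × 𝓞 → 𝓐} {P : Measure Ω} [IsProbabilityMeasure P]
  {Θ : Ω → 𝓞} {X : ℕ → Ω → 𝓧} {Θhat : ℕ → Ω → 𝓞} {R : ℕ → Ω → ℝ}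

lemma IsThompsonSampling.aemeasurable_all (hTS : Φ.IsThompsonSampling T ψ P Θ X Θhat R) {t : ℕ}
    (ht : t < T) : AEMeasurable
      (fun ω => (Θ ω, history ψ X Θhat R t ω, X t ω, Θhat t ω, R t ω)) P := by
  have h := hTS.law_reward t ht
  have h1 := h.aemeasurable_fst
  have h2 := h.aemeasurable_snd
  exact h1.fst.prodMk (h1.snd.fst.prodMk (h1.snd.snd.fst.prodMk (h1.snd.snd.snd.prodMk h2)))

lemma IsThompsonSampling.hasCondDistrib_parameter (hTS : Φ.IsThompsonSampling T ψ P Θ X Θhat R)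
    {t : ℕ} (ht : t < T) : HasCondDistrib Θ (history ψ X Θhat R t)
      (condDistrib Θ (history ψ X Θhat R t) P) P := by
  have h := hTS.aemeasurable_all ht
  refine ⟨h.snd.fst.prodMk h.fst, ?_⟩
  rw [compProd_map_condDistrib h.fst]

/-- Given the history and the context, the parameter and its estimate are independent draws from
the posterior. -/
lemma IsThompsonSampling.integral_resample (hTS : Φ.IsThompsonSampling T ψ P Θ X Θhat R)
    {t : ℕ} (ht : t < T) {F : 𝓞 → (Fin t → 𝓧 × 𝓐 × ℝ) → 𝓧 → 𝓞 → ℝ}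
    (hF : Measurable fun z : 𝓞 × (Fin t → 𝓧 × 𝓐 × ℝ) × 𝓧 × 𝓞 => F z.1 z.2.1 z.2.2.1 z.2.2.2)
    {B : ℝ} (hB : ∀ θ h x θ', |F θ h x θ'| ≤ B) :
    ∫ ω, F (Θ ω) (history ψ X Θhat R t ω) (X t ω) (Θhat t ω) ∂P
      = ∫ ω, ∫ θ', ∫ θ, F θ (history ψ X Θhat R t ω) (X t ω) θ'
          ∂(condDistrib Θ (history ψ X Θhat R t) P (history ψ X Θhat R t ω))
          ∂(condDistrib Θ (history ψ X Θhat R t) P (history ψ X Θhat R t ω)) ∂P := by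
  set H := history ψ X Θhat R t with hH
  set π := condDistrib Θ H P with hπ
  -- integrate out the estimate, the context and the parameter, in this order
  have m1 : Measurable fun z : 𝓞 × (Fin t → 𝓧 × 𝓐 × ℝ) × 𝓧 =>
      ∫ θ', F z.1 z.2.1 z.2.2 θ' ∂(π z.2.1) := by
    have := StronglyMeasurable.integral_kernel_prod_right'
      (κ := π.comap (fun z : 𝓞 × (Fin t → 𝓧 × 𝓐 × ℝ) × 𝓧 => z.2.1) (by fun_prop))
      (f := fun w : (𝓞 × (Fin t → 𝓧 × 𝓐 × ℝ) × 𝓧) × 𝓞 => F w.1.1 w.1.2.1 w.1.2.2 w.2)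
      (hF.comp (f := fun w : (𝓞 × (Fin t → 𝓧 × 𝓐 × ℝ) × 𝓧) × 𝓞 =>
        (w.1.1, w.1.2.1, w.1.2.2, w.2)) (by fun_prop)).stronglyMeasurable
    exact this.measurable
  have b1 : ∀ θ h x, |∫ θ', F θ h x θ' ∂(π h)| ≤ B := fun θ h x =>
    abs_integral_le_of_abs_le (hB θ h x)
  have m2 : Measurable fun z : (Fin t → 𝓧 × 𝓐 × ℝ) × 𝓞 =>
      ∫ x, ∫ θ', F z.2 z.1 x θ' ∂(π z.1) ∂Φ.context := by
    refine (StronglyMeasurable.integral_prod_right' (ν := Φ.context)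
      (f := fun w : ((Fin t → 𝓧 × 𝓐 × ℝ) × 𝓞) × 𝓧 => ∫ θ', F w.1.2 w.1.1 w.2 θ' ∂(π w.1.1))
      ?_).measurable
    exact (m1.comp (f := fun w : ((Fin t → 𝓧 × 𝓐 × ℝ) × 𝓞) × 𝓧 => (w.1.2, w.1.1, w.2))
      (by fun_prop)).stronglyMeasurable
  have s1 := HasCondDistrib.integral_comp (hTS.law_sample t ht)
    (F := fun z θ' => F z.1 z.2.1 z.2.2 θ')
    (hF.comp (f := fun w : (𝓞 × (Fin t → 𝓧 × 𝓐 × ℝ) × 𝓧) × 𝓞 => (w.1.1, w.1.2.1, w.1.2.2, w.2))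
      (by fun_prop)) (fun z θ' => hB _ _ _ _)
  have s2 := HasCondDistrib.integral_comp (hTS.law_context t ht)
    (F := fun z x => ∫ θ', F z.1 z.2 x θ' ∂(π z.2))
    (m1.comp (f := fun w : (𝓞 × (Fin t → 𝓧 × 𝓐 × ℝ)) × 𝓧 => (w.1.1, w.1.2, w.2))
      (by fun_prop)) (fun z x => b1 _ _ _)
  have s3 := HasCondDistrib.integral_comp (hTS.hasCondDistrib_parameter ht)
    (F := fun h θ => ∫ x, ∫ θ', F θ h x θ' ∂(π h) ∂Φ.context) m2
    (fun h θ => abs_integral_le_of_abs_le (b1 θ h))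
  have m4 := measurable_integral_integral_kernel π hF
  have s4 := HasCondDistrib.integral_comp (hTS.law_context t ht)
    (F := fun z x => ∫ θ', ∫ θ, F θ z.2 x θ' ∂(π z.2) ∂(π z.2))
    (m4.comp (f := fun w : (𝓞 × (Fin t → 𝓧 × 𝓐 × ℝ)) × 𝓧 => (w.1.2, w.2))
      (by fun_prop)) (fun z x => abs_integral_le_of_abs_le fun θ' =>
        abs_integral_le_of_abs_le fun θ => hB _ _ _ _)
  have s5 : ∀ h, ∫ θ, ∫ x, ∫ θ', F θ h x θ' ∂(π h) ∂Φ.context ∂(π h)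
      = ∫ x, ∫ θ', ∫ θ, F θ h x θ' ∂(π h) ∂(π h) ∂Φ.context := fun h =>
    integral_integral_integral_rotate (F := fun θ x θ' => F θ h x θ')
      (hF.comp (f := fun w : 𝓞 × 𝓧 × 𝓞 => (w.1, h, w.2.1, w.2.2)) (by fun_prop))
      (fun _ _ _ => hB _ _ _ _)
  simp only [Kernel.comap_apply, Kernel.const_apply] at s1 s2 s3 s4
  rw [s1, s2, s3, s4]
  exact integral_congr_ae (ae_of_all _ fun ω => s5 _)

lemma IsThompsonSampling.integrable_resample (hTS : Φ.IsThompsonSampling T ψ P Θ X Θhat R)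
    {t : ℕ} (ht : t < T) {F : 𝓞 → (Fin t → 𝓧 × 𝓐 × ℝ) → 𝓧 → 𝓞 → ℝ}
    (hF : Measurable fun z : 𝓞 × (Fin t → 𝓧 × 𝓐 × ℝ) × 𝓧 × 𝓞 => F z.1 z.2.1 z.2.2.1 z.2.2.2)
    {B : ℝ} (hB : ∀ θ h x θ', |F θ h x θ'| ≤ B) :
    Integrable (fun ω => ∫ θ', ∫ θ, F θ (history ψ X Θhat R t ω) (X t ω) θ'
      ∂(condDistrib Θ (history ψ X Θhat R t) P (history ψ X Θhat R t ω))
      ∂(condDistrib Θ (history ψ X Θhat R t) P (history ψ X Θhat R t ω))) P := by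
  have h := hTS.aemeasurable_all ht
  have hm := (measurable_integral_integral_kernel
    (condDistrib Θ (history ψ X Θhat R t) P) hF).comp_aemeasurable
    (h.snd.fst.prodMk h.snd.snd.fst)
  exact Integrable.of_bound hm.aestronglyMeasurable B (ae_of_all _ fun ω =>
    abs_integral_le_of_abs_le fun θ' => abs_integral_le_of_abs_le fun θ => hB _ _ _ _)

/-- The context of the current round does not change the posterior law of the parameter. -/
lemma IsThompsonSampling.integral_posterior (hTS : Φ.IsThompsonSampling T ψ P Θ X Θhat R)
    {t : ℕ} (ht : t < T) {G : 𝓞 → 𝓧 → ℝ} (hG : Measurable fun z : 𝓞 × 𝓧 => G z.1 z.2)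
    {B : ℝ} (hB : ∀ θ x, |G θ x| ≤ B) :
    ∫ ω, G (Θ ω) (X t ω) ∂P
      = ∫ ω, ∫ θ, G θ (X t ω)
          ∂(condDistrib Θ (history ψ X Θhat R t) P (history ψ X Θhat R t ω)) ∂P := by
  have := hTS.integral_resample ht (F := fun θ _ x _ => G θ x)
    (hG.comp (f := fun z : 𝓞 × (Fin t → 𝓧 × 𝓐 × ℝ) × 𝓧 × 𝓞 => (z.1, z.2.2.1)) (by fun_prop))
    (fun _ _ _ _ => hB _ _)
  simpa using this

/-- The context is independent of the parameter. -/
lemma IsThompsonSampling.integral_context (hTS : Φ.IsThompsonSampling T ψ P Θ X Θhat R)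
    {t : ℕ} (ht : t < T) {G : 𝓧 × 𝓞 → ℝ} (hG : Measurable G)
    {B : ℝ} (hB : ∀ z, |G z| ≤ B) :
    ∫ ω, G (X t ω, Θ ω) ∂P = ∫ z, G z ∂(Φ.context.prod Φ.prior) := by
  have h1 := HasCondDistrib.integral_comp (hTS.law_context t ht)
    (F := fun z x => G (x, z.1)) (by fun_prop) (fun z x => hB _)
  simp only [Kernel.const_apply] at h1
  have hm : Measurable fun θ => ∫ x, G (x, θ) ∂Φ.context :=
    hG.stronglyMeasurable.integral_prod_left'.measurable
  rw [h1, integral_prod_symm _ (integrable_of_measurable_of_abs_le hG hB),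
    ← hTS.law_parameter.map_eq,
    integral_map hTS.law_parameter.aemeasurable hm.aestronglyMeasurable]

end Tower

section Laplace

variable {𝓞 𝓧 𝓐 Ω : Type*} [MeasurableSpace 𝓞] [MeasurableSpace 𝓧] [MeasurableSpace 𝓐]
  [StandardBorelSpace 𝓞] [Nonempty 𝓞] [MeasurableSpace Ω]
  {Φ : ContextualBandit 𝓞 𝓧 𝓐} {T : ℕ} {ψ : 𝓧 × 𝓞 → 𝓐} {P : Measure Ω} [IsProbabilityMeasure P]
  {Θ : Ω → 𝓞} {X : ℕ → Ω → 𝓧} {Θhat : ℕ → Ω → 𝓞} {R : ℕ → Ω → ℝ}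
  {O : Set 𝓞} {f : 𝓞 → 𝓧 → 𝓐 → ℝ} {L β : ℝ}

lemma IsThompsonSampling.ae_mem (hTS : Φ.IsThompsonSampling T ψ P Θ X Θhat R)
    (hprior : ∀ᵐ θ ∂Φ.prior, θ ∈ O) : ∀ᵐ ω ∂P, Θ ω ∈ O := by
  rw [← hTS.law_parameter.map_eq] at hprior
  exact ae_of_ae_map hTS.law_parameter.aemeasurable hprior

/-- The reward has the Laplace density given the parameter and everything before. -/
lemma IsThompsonSampling.integral_reward (hTS : Φ.IsThompsonSampling T ψ P Θ X Θhat R)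
    (hprior : ∀ᵐ θ ∂Φ.prior, θ ∈ O) (hlik : Φ.HasLaplaceLikelihood O f L β)
    (hL : 0 < L) (hβ : 0 < β)
    {t : ℕ} (ht : t < T) {F : 𝓞 → (Fin t → 𝓧 × 𝓐 × ℝ) → 𝓧 → 𝓞 → ℝ → ℝ}
    (hF : Measurable fun z : 𝓞 × (Fin t → 𝓧 × 𝓐 × ℝ) × 𝓧 × 𝓞 × ℝ =>
      F z.1 z.2.1 z.2.2.1 z.2.2.2.1 z.2.2.2.2)
    {B : ℝ} (hB : ∀ θ h x θ' r, |F θ h x θ' r| ≤ B) :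
    ∫ ω, F (Θ ω) (history ψ X Θhat R t ω) (X t ω) (Θhat t ω) (R t ω) ∂P
      = ∫ ω, (∫ r in Set.Icc 0 L,
          laplaceDensity L β (f (Θ ω) (X t ω) (action ψ X Θhat t ω)) r *
          F (Θ ω) (history ψ X Θhat R t ω) (X t ω) (Θhat t ω) r) ∂P := by
  have hψ := hTS.measurable_policy
  have h1 := HasCondDistrib.integral_comp (hTS.law_reward t ht)
    (F := fun z r => F z.1 z.2.1 z.2.2.1 z.2.2.2 r)
    (hF.comp (f := fun w : (𝓞 × (Fin t → 𝓧 × 𝓐 × ℝ) × 𝓧 × 𝓞) × ℝ =>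
      (w.1.1, w.1.2.1, w.1.2.2.1, w.1.2.2.2, w.2)) (by fun_prop)) (fun _ _ => hB _ _ _ _ _)
  rw [h1]
  refine integral_congr_ae ?_
  filter_upwards [hTS.ae_mem hprior] with ω hω
  rw [Kernel.comap_apply]
  simp only
  rw [hlik _ hω, integral_boundedLaplace hL hβ]
  rfl

/-- The reward is a.s. in `[0, L]`: the reward kernel charges no other values when the parameter is
in `O`. -/
lemma IsThompsonSampling.ae_reward_mem (hTS : Φ.IsThompsonSampling T ψ P Θ X Θhat R)
    (hprior : ∀ᵐ θ ∂Φ.prior, θ ∈ O) (hlik : Φ.HasLaplaceLikelihood O f L β)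
    (hL : 0 < L) (hβ : 0 < β) {t : ℕ} (ht : t < T) :
    ∀ᵐ ω ∂P, R t ω ∈ Set.Icc 0 L := by
  have hR : AEMeasurable (R t) P := (hTS.aemeasurable_all ht).snd.snd.snd.snd
  have hl := hTS.law_reward t ht
  have hX := hl.aemeasurable_fst
  have hm := hl.map_eq
  have hs : MeasurableSet {z : (𝓞 × (Fin t → 𝓧 × 𝓐 × ℝ) × 𝓧 × 𝓞) × ℝ | z.2 ∈ Set.Icc 0 L} :=
    measurable_snd measurableSet_Icc
  refine (ae_map_iff hl.aemeasurable hs).1 ?_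
  rw [hm]
  refine (Measure.ae_compProd_iff hs).2 (ae_map_iff hX ?_ |>.2 ?_)
  · exact Kernel.measurable_coe _ measurableSet_Icc.compl (measurableSet_singleton 0)
  · filter_upwards [hTS.ae_mem hprior] with ω hω
    rw [Kernel.comap_apply, hlik _ hω, boundedLaplace_eq_withDensity hL hβ]
    exact (withDensity_absolutelyContinuous _ _).ae_le (ae_restrict_mem measurableSet_Icc)

end Laplace

end ContextualBandit

/-! ### Predictive densities and the information of one round -/

namespace ContextualBandit

section Predictive

variable {𝓗 𝓞 𝓧 𝓐 : Type*} [MeasurableSpace 𝓗] [MeasurableSpace 𝓞] [MeasurableSpace 𝓧]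
  [MeasurableSpace 𝓐] {f : 𝓞 → 𝓧 → 𝓐 → ℝ} {L β : ℝ}

/-- The predictive density of the reward given the history `h`: for the round `z = (x, a, r)` it is
the density of the reward `r` in context `x` under action `a`, averaged over the posterior `π h` of
the parameter. -/
noncomputable def predictiveDensity (L β : ℝ) (f : 𝓞 → 𝓧 → 𝓐 → ℝ) (π : Kernel 𝓗 𝓞) (h : 𝓗)
    (z : 𝓧 × 𝓐 × ℝ) : ℝ :=
  ∫ θ, laplaceDensity L β (f θ z.1 z.2.1) z.2.2 ∂(π h)

lemma measurable_likelihood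
    (hf : Measurable fun p : 𝓞 × 𝓧 × 𝓐 => f p.1 p.2.1 p.2.2) (L β : ℝ) :
    Measurable fun w : 𝓞 × 𝓧 × 𝓐 × ℝ => laplaceDensity L β (f w.1 w.2.1 w.2.2.1) w.2.2.2 :=
  Measurable.laplaceDensity (hf.comp (f := fun w : 𝓞 × 𝓧 × 𝓐 × ℝ => (w.1, w.2.1, w.2.2.1))
    (by fun_prop)) (by fun_prop)

lemma measurable_predictiveDensity
    (hf : Measurable fun p : 𝓞 × 𝓧 × 𝓐 => f p.1 p.2.1 p.2.2) (π : Kernel 𝓗 𝓞)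
    [IsMarkovKernel π] :
    Measurable fun w : 𝓗 × 𝓧 × 𝓐 × ℝ => predictiveDensity L β f π w.1 w.2 := by
  have := StronglyMeasurable.integral_kernel_prod_right'
    (κ := π.comap (fun w : 𝓗 × 𝓧 × 𝓐 × ℝ => w.1) (by fun_prop))
    (f := fun w : (𝓗 × 𝓧 × 𝓐 × ℝ) × 𝓞 =>
      laplaceDensity L β (f w.2 w.1.2.1 w.1.2.2.1) w.1.2.2.2)
    ((measurable_likelihood hf L β).comp (f := fun w : (𝓗 × 𝓧 × 𝓐 × ℝ) × 𝓞 => (w.2, w.1.2))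
      (by fun_prop)).stronglyMeasurable
  exact this.measurable

lemma predictiveDensity_mem (hf : Measurable fun p : 𝓞 × 𝓧 × 𝓐 => f p.1 p.2.1 p.2.2)
    (hL : 0 < L) (hβ : 0 < β) (π : Kernel 𝓗 𝓞) [IsMarkovKernel π] (h : 𝓗) (z : 𝓧 × 𝓐 × ℝ) :
    predictiveDensity L β f π h z
      ∈ Set.Icc (Real.exp (-L / β) / L) (1 / (L * Real.exp (-L / β))) :=
  integral_mem_Icc ((measurable_likelihood hf L β).comp (f := fun θ => (θ, z)) (by fun_prop))
    fun θ => laplaceDensity_mem hL hβ _ _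

lemma predictiveDensity_pos (hf : Measurable fun p : 𝓞 × 𝓧 × 𝓐 => f p.1 p.2.1 p.2.2)
    (hL : 0 < L) (hβ : 0 < β) (π : Kernel 𝓗 𝓞) [IsMarkovKernel π] (h : 𝓗) (z : 𝓧 × 𝓐 × ℝ) :
    0 < predictiveDensity L β f π h z :=
  (by positivity : 0 < Real.exp (-L / β) / L).trans_le (predictiveDensity_mem hf hL hβ π h z).1

/-- The mean of the Laplace law with location `m` on `[0, L]`. -/
noncomputable def laplaceMean (L β m : ℝ) : ℝ :=
  ∫ r in Set.Icc 0 L, laplaceDensity L β m r * r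

lemma measurable_laplaceMean (L β : ℝ) : Measurable (laplaceMean L β) := by
  have := StronglyMeasurable.integral_prod_right' (ν := volume.restrict (Set.Icc 0 L))
    (f := fun w : ℝ × ℝ => laplaceDensity L β w.1 w.2 * w.2)
    ((measurable_laplaceDensity L β).mul measurable_snd).stronglyMeasurable
  exact this.measurable

lemma _root_.Measurable.laplaceMean {α : Type*} [MeasurableSpace α] {m : α → ℝ}
    (hm : Measurable m) : Measurable fun x => laplaceMean L β (m x) :=
  (measurable_laplaceMean L β).comp hm

lemma abs_laplaceMean_le (hL : 0 < L) (hβ : 0 < β) (m : ℝ) :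
    |laplaceMean L β m| ≤ 1 / (L * Real.exp (-L / β)) * L * L := by
  have := norm_setIntegral_le_of_norm_le_const (μ := volume) (s := Set.Icc 0 L)
    (f := fun r => laplaceDensity L β m r * r) (C := 1 / (L * Real.exp (-L / β)) * L) (by simp)
    fun r hr => by
      rw [norm_mul, Real.norm_eq_abs, Real.norm_eq_abs, abs_of_pos (laplaceDensity_pos hL hβ m r),
        abs_of_nonneg hr.1]
      exact mul_le_mul (laplaceDensity_mem hL hβ m r).2 hr.2 hr.1 (by positivity)
  simpa [laplaceMean, hL.le] using this

lemma abs_log_laplaceDensity_div_le (hL : 0 < L) (hβ : 0 < β) (m r : ℝ) {v : ℝ}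
    (hv : v ∈ Set.Icc (Real.exp (-L / β) / L) (1 / (L * Real.exp (-L / β)))) :
    |Real.log (laplaceDensity L β m r / v)|
      ≤ Real.log (1 / (L * Real.exp (-L / β)) / (Real.exp (-L / β) / L)) :=
  abs_log_div_le (by positivity) (laplaceDensity_mem hL hβ m r) hv

lemma abs_setIntegral_laplaceDensity_mul_le (hL : 0 < L) (hβ : 0 < β) (m : ℝ) {g : ℝ → ℝ} {B : ℝ}
    (hg : ∀ r, |g r| ≤ B) :
    |∫ r in Set.Icc 0 L, laplaceDensity L β m r * g r| ≤ 1 / (L * Real.exp (-L / β)) * B * L := by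
  have := norm_setIntegral_le_of_norm_le_const (μ := volume) (s := Set.Icc 0 L)
    (f := fun r => laplaceDensity L β m r * g r) (C := 1 / (L * Real.exp (-L / β)) * B) (by simp)
    fun r _ => by
      rw [norm_mul, Real.norm_eq_abs, Real.norm_eq_abs, abs_of_pos (laplaceDensity_pos hL hβ m r)]
      exact mul_le_mul (laplaceDensity_mem hL hβ m r).2 (hg r) (abs_nonneg _) (by positivity)
  simpa [hL.le] using this

/-- Averaging over the posterior turns the likelihood of the reward into its predictive density,
which cancels against the denominator. -/
lemma integral_integral_mul_div_predictiveDensity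
    (hf : Measurable fun p : 𝓞 × 𝓧 × 𝓐 => f p.1 p.2.1 p.2.2) (hL : 0 < L) (hβ : 0 < β)
    (π : Kernel 𝓗 𝓞) [IsMarkovKernel π] (h : 𝓗) (x : 𝓧) (a : 𝓐) (m b : ℝ) :
    ∫ θ, (∫ r in Set.Icc 0 L, laplaceDensity L β (f θ x a) r *
      (b * (laplaceDensity L β m r / predictiveDensity L β f π h (x, a, r)))) ∂(π h) = b := by
  set c := Real.exp (-L / β) / L with hc
  set K := 1 / (L * Real.exp (-L / β)) with hK
  have hc0 : 0 < c := by positivity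
  have hK0 : 0 < K := by positivity
  have hm1 : Measurable fun z : 𝓞 × ℝ => laplaceDensity L β (f z.1 x a) z.2 :=
    (measurable_likelihood hf L β).comp (f := fun z : 𝓞 × ℝ => (z.1, x, a, z.2)) (by fun_prop)
  have hm2 : Measurable fun z : 𝓞 × ℝ => laplaceDensity L β m z.2 :=
    (measurable_laplaceDensity_right L β m).comp measurable_snd
  have hm3 : Measurable fun z : 𝓞 × ℝ => predictiveDensity L β f π h (x, a, z.2) :=
    (measurable_predictiveDensity hf π).comp (f := fun z : 𝓞 × ℝ => (h, x, a, z.2)) (by fun_prop)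
  have hi : Integrable (fun z : 𝓞 × ℝ => laplaceDensity L β (f z.1 x a) z.2 *
      (b * (laplaceDensity L β m z.2 / predictiveDensity L β f π h (x, a, z.2))))
      ((π h).prod (volume.restrict (Set.Icc 0 L))) := by
    refine integrable_of_measurable_of_abs_le (B := K * (|b| * (K / c)))
      (hm1.mul (measurable_const.mul (hm2.div hm3))) fun z => ?_
    have h1 := laplaceDensity_mem hL hβ (f z.1 x a) z.2
    have h2 := laplaceDensity_mem hL hβ m z.2
    have h3 := predictiveDensity_mem hf hL hβ π h (x, a, z.2)
    rw [abs_mul, abs_mul, abs_div, abs_of_pos (hc0.trans_le h1.1), abs_of_pos (hc0.trans_le h2.1),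
      abs_of_pos (hc0.trans_le h3.1)]
    have h4 := div_le_div₀ hK0.le h2.2 hc0 h3.1
    have h5 : 0 ≤ laplaceDensity L β m z.2 / predictiveDensity L β f π h (x, a, z.2) :=
      div_nonneg (hc0.le.trans h2.1) (hc0.le.trans h3.1)
    exact mul_le_mul h1.2 (mul_le_mul_of_nonneg_left h4 (abs_nonneg b))
      (mul_nonneg (abs_nonneg b) h5) hK0.le
  rw [integral_integral_swap (f := fun θ r => laplaceDensity L β (f θ x a) r *
      (b * (laplaceDensity L β m r / predictiveDensity L β f π h (x, a, r)))) hi]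
  have key : ∀ r, ∫ θ, laplaceDensity L β (f θ x a) r *
      (b * (laplaceDensity L β m r / predictiveDensity L β f π h (x, a, r))) ∂(π h)
      = b * laplaceDensity L β m r := by
    intro r
    have h3 := predictiveDensity_pos hf hL hβ π h (x, a, r)
    rw [integral_mul_const]
    change predictiveDensity L β f π h (x, a, r) * _ = _
    field_simp
  simp_rw [key]
  rw [integral_const_mul, integral_laplaceDensity hL hβ, mul_one]

end Predictive

section Round

variable {𝓞 𝓧 𝓐 Ω : Type*} [MeasurableSpace 𝓞] [MeasurableSpace 𝓧] [MeasurableSpace 𝓐]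
  [StandardBorelSpace 𝓞] [Nonempty 𝓞] [MeasurableSpace Ω]
  {Φ : ContextualBandit 𝓞 𝓧 𝓐} {T : ℕ} {ψ : 𝓧 × 𝓞 → 𝓐} {P : Measure Ω} [IsProbabilityMeasure P]
  {Θ : Ω → 𝓞} {X : ℕ → Ω → 𝓧} {Θhat : ℕ → Ω → 𝓞} {R : ℕ → Ω → ℝ}
  {O : Set 𝓞} {f : 𝓞 → 𝓧 → 𝓐 → ℝ} {L β : ℝ}

/-- The predictive density of round `t` at the outcome `(X_t, A_t, R_t)` of that round. -/
noncomputable def predictive (L β : ℝ) (f : 𝓞 → 𝓧 → 𝓐 → ℝ) (ψ : 𝓧 × 𝓞 → 𝓐) (P : Measure Ω)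
    [IsProbabilityMeasure P] (Θ : Ω → 𝓞) (X : ℕ → Ω → 𝓧) (Θhat : ℕ → Ω → 𝓞) (R : ℕ → Ω → ℝ)
    (t : ℕ) (ω : Ω) : ℝ :=
  predictiveDensity L β f (condDistrib Θ (history ψ X Θhat R t) P) (history ψ X Θhat R t ω)
    (X t ω, action ψ X Θhat t ω, R t ω)

/-- The likelihood of the outcome of round `t` under the parameter `θ`. -/
noncomputable def likelihood (L β : ℝ) (f : 𝓞 → 𝓧 → 𝓐 → ℝ) (ψ : 𝓧 × 𝓞 → 𝓐) (X : ℕ → Ω → 𝓧)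
    (Θhat : ℕ → Ω → 𝓞) (R : ℕ → Ω → ℝ) (t : ℕ) (θ : 𝓞) (ω : Ω) : ℝ :=
  laplaceDensity L β (f θ (X t ω) (action ψ X Θhat t ω)) (R t ω)

/-- The expected reward of the optimal policy in one round: the parameter is drawn from the posterior
and the action is optimal for the same parameter. -/
lemma IsThompsonSampling.integral_roundLaw (hTS : Φ.IsThompsonSampling T ψ P Θ X Θhat R)
    (hprior : ∀ᵐ θ ∂Φ.prior, θ ∈ O) (hlik : Φ.HasLaplaceLikelihood O f L β)
    (hf : Measurable fun p : 𝓞 × 𝓧 × 𝓐 => f p.1 p.2.1 p.2.2)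
    (hL : 0 < L) (hβ : 0 < β) (hψ : Measurable ψ)
    (hint : Integrable (fun q : (𝓧 × 𝓞) × ℝ => q.2) (Φ.roundLaw ψ hψ)) {t : ℕ} (ht : t < T) :
    ∫ q, q.2 ∂(Φ.roundLaw ψ hψ) = ∫ ω, ∫ θ, laplaceMean L β (f θ (X t ω) (ψ (X t ω, θ)))
      ∂(condDistrib Θ (history ψ X Θhat R t) P (history ψ X Θhat R t ω)) ∂P := by
  have hm : Measurable fun z : 𝓞 × 𝓧 => laplaceMean L β (f z.1 z.2 (ψ (z.2, z.1))) :=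
    Measurable.laplaceMean (hf.comp
      (f := fun z : 𝓞 × 𝓧 => (z.1, z.2, ψ (z.2, z.1))) (by fun_prop))
  rw [← hTS.integral_posterior ht (G := fun θ x => laplaceMean L β (f θ x (ψ (x, θ)))) hm
    (fun _ _ => abs_laplaceMean_le hL hβ _),
    hTS.integral_context ht (G := fun z => laplaceMean L β (f z.2 z.1 (ψ z)))
    (Measurable.laplaceMean (hf.comp (f := fun z : 𝓧 × 𝓞 => (z.2, z.1, ψ z)) (by fun_prop))) (fun _ => abs_laplaceMean_le hL hβ _)]
  rw [roundLaw, Measure.integral_compProd hint]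
  refine integral_congr_ae ?_
  have hO : ∀ᵐ z ∂(Φ.context.prod Φ.prior), z.2 ∈ O :=
    Measure.quasiMeasurePreserving_snd.ae hprior
  filter_upwards [hO] with z hz
  rw [Kernel.comap_apply, hlik _ hz, integral_boundedLaplace hL hβ, laplaceMean]

/-- The expected reward of Thompson Sampling in one round: the parameter and the estimate to which the
action is optimal are independent draws from the posterior. -/
lemma IsThompsonSampling.integral_reward_eq (hTS : Φ.IsThompsonSampling T ψ P Θ X Θhat R)
    (hprior : ∀ᵐ θ ∂Φ.prior, θ ∈ O) (hlik : Φ.HasLaplaceLikelihood O f L β)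
    (hf : Measurable fun p : 𝓞 × 𝓧 × 𝓐 => f p.1 p.2.1 p.2.2)
    (hL : 0 < L) (hβ : 0 < β) {t : ℕ} (ht : t < T) :
    ∫ ω, R t ω ∂P = ∫ ω, ∫ θ', ∫ θ, laplaceMean L β (f θ (X t ω) (ψ (X t ω, θ')))
      ∂(condDistrib Θ (history ψ X Θhat R t) P (history ψ X Θhat R t ω))
      ∂(condDistrib Θ (history ψ X Θhat R t) P (history ψ X Θhat R t ω)) ∂P := by
  have hψ := hTS.measurable_policy
  have hm : Measurable fun z : 𝓞 × (Fin t → 𝓧 × 𝓐 × ℝ) × 𝓧 × 𝓞 =>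
      laplaceMean L β (f z.1 z.2.2.1 (ψ (z.2.2.1, z.2.2.2))) :=
    Measurable.laplaceMean (hf.comp
      (f := fun z : 𝓞 × (Fin t → 𝓧 × 𝓐 × ℝ) × 𝓧 × 𝓞 =>
        (z.1, z.2.2.1, ψ (z.2.2.1, z.2.2.2))) (by fun_prop))
  rw [← hTS.integral_resample ht (F := fun θ _ x θ' => laplaceMean L β (f θ x (ψ (x, θ')))) hm
    (fun _ _ _ _ => abs_laplaceMean_le hL hβ _)]
  calc ∫ ω, R t ω ∂P = ∫ ω, clip L (R t ω) ∂P := by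
        refine integral_congr_ae ?_
        filter_upwards [hTS.ae_reward_mem hprior hlik hL hβ ht] with ω hω
        rw [clip_of_mem hω]
    _ = ∫ ω, (∫ r in Set.Icc 0 L,
          laplaceDensity L β (f (Θ ω) (X t ω) (action ψ X Θhat t ω)) r * clip L r) ∂P :=
        hTS.integral_reward hprior hlik hL hβ ht (F := fun _ _ _ _ r => clip L r) (B := L)
          ((continuous_clip L).measurable.comp (f := fun z : 𝓞 × (Fin t → 𝓧 × 𝓐 × ℝ) × 𝓧 × 𝓞 × ℝ =>
            z.2.2.2.2) (by fun_prop))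
          (fun _ _ _ _ r => by rw [abs_of_nonneg (clip_mem hL r).1]; exact (clip_mem hL r).2)
    _ = _ := by
        refine integral_congr_ae (ae_of_all _ fun ω => ?_)
        refine setIntegral_congr_fun measurableSet_Icc fun r hr => ?_
        simp only [clip_of_mem hr]
        rfl

variable [Fintype 𝓐] [DiscreteMeasurableSpace 𝓐]

/-- The regret of one round is bounded by the number of actions and by the information that the
reward of the round carries about the parameter. -/
lemma IsThompsonSampling.round_regret_le (hTS : Φ.IsThompsonSampling T ψ P Θ X Θhat R)
    (hprior : ∀ᵐ θ ∂Φ.prior, θ ∈ O) (hlik : Φ.HasLaplaceLikelihood O f L β)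
    (hf : Measurable fun p : 𝓞 × 𝓧 × 𝓐 => f p.1 p.2.1 p.2.2)
    (hL : 0 < L) (hβ : 0 < β) (hψ : Measurable ψ)
    (hint : Integrable (fun q : (𝓧 × 𝓞) × ℝ => q.2) (Φ.roundLaw ψ hψ)) {t : ℕ} (ht : t < T)
    {s : ℝ} (hs : 0 < s) :
    (∫ q, q.2 ∂(Φ.roundLaw ψ hψ)) - ∫ ω, R t ω ∂P
      ≤ Fintype.card 𝓐 * L ^ 2 / (8 * s) + s * ∫ ω, Real.log
        (likelihood L β f ψ X Θhat R t (Θ ω) ω / predictive L β f ψ P Θ X Θhat R t ω) ∂P := by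
  set H := history ψ X Θhat R t with hH
  set π := condDistrib Θ H P with hπ
  have hlm := measurable_likelihood hf L β
  have hqm := measurable_predictiveDensity (L := L) (β := β) hf π
  -- the information, as an integral over two independent draws from the posterior
  have hFm : Measurable fun z : 𝓞 × (Fin t → 𝓧 × 𝓐 × ℝ) × 𝓧 × 𝓞 × ℝ => Real.log
      (laplaceDensity L β (f z.1 z.2.2.1 (ψ (z.2.2.1, z.2.2.2.1))) z.2.2.2.2
        / predictiveDensity L β f π z.2.1 (z.2.2.1, ψ (z.2.2.1, z.2.2.2.1), z.2.2.2.2)) := by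
    refine Measurable.log (Measurable.div ?_ ?_)
    · exact hlm.comp (f := fun z : 𝓞 × (Fin t → 𝓧 × 𝓐 × ℝ) × 𝓧 × 𝓞 × ℝ =>
        (z.1, z.2.2.1, ψ (z.2.2.1, z.2.2.2.1), z.2.2.2.2)) (by fun_prop)
    · exact hqm.comp (f := fun z : 𝓞 × (Fin t → 𝓧 × 𝓐 × ℝ) × 𝓧 × 𝓞 × ℝ =>
        (z.2.1, z.2.2.1, ψ (z.2.2.1, z.2.2.2.1), z.2.2.2.2)) (by fun_prop)
  have hFb : ∀ (θ : 𝓞) (h : Fin t → 𝓧 × 𝓐 × ℝ) (x : 𝓧) (θ' : 𝓞) (r : ℝ), |Real.log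
      (laplaceDensity L β (f θ x (ψ (x, θ'))) r / predictiveDensity L β f π h (x, ψ (x, θ'), r))|
      ≤ Real.log (1 / (L * Real.exp (-L / β)) / (Real.exp (-L / β) / L)) := fun θ h x θ' r =>
    abs_log_laplaceDensity_div_le hL hβ _ _ (predictiveDensity_mem hf hL hβ π _ _)
  have hDm : Measurable fun z : 𝓞 × (Fin t → 𝓧 × 𝓐 × ℝ) × 𝓧 × 𝓞 => ∫ r in Set.Icc 0 L,
      laplaceDensity L β (f z.1 z.2.2.1 (ψ (z.2.2.1, z.2.2.2))) r * Real.log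
      (laplaceDensity L β (f z.1 z.2.2.1 (ψ (z.2.2.1, z.2.2.2))) r
        / predictiveDensity L β f π z.2.1 (z.2.2.1, ψ (z.2.2.1, z.2.2.2), r)) := by
    have := StronglyMeasurable.integral_prod_right' (ν := volume.restrict (Set.Icc 0 L))
      (f := fun w : (𝓞 × (Fin t → 𝓧 × 𝓐 × ℝ) × 𝓧 × 𝓞) × ℝ =>
        laplaceDensity L β (f w.1.1 w.1.2.2.1 (ψ (w.1.2.2.1, w.1.2.2.2))) w.2 * Real.log
        (laplaceDensity L β (f w.1.1 w.1.2.2.1 (ψ (w.1.2.2.1, w.1.2.2.2))) w.2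
        / predictiveDensity L β f π w.1.2.1 (w.1.2.2.1, ψ (w.1.2.2.1, w.1.2.2.2), w.2)))
      (Measurable.mul
        (hlm.comp (f := fun w : (𝓞 × (Fin t → 𝓧 × 𝓐 × ℝ) × 𝓧 × 𝓞) × ℝ =>
          (w.1.1, w.1.2.2.1, ψ (w.1.2.2.1, w.1.2.2.2), w.2)) (by fun_prop))
        (hFm.comp (f := fun w : (𝓞 × (Fin t → 𝓧 × 𝓐 × ℝ) × 𝓧 × 𝓞) × ℝ =>
          (w.1.1, w.1.2.1, w.1.2.2.1, w.1.2.2.2, w.2)) (by fun_prop))).stronglyMeasurable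
    exact this.measurable
  have hDb := fun (θ : 𝓞) (h : Fin t → 𝓧 × 𝓐 × ℝ) (x : 𝓧) (θ' : 𝓞) =>
    abs_setIntegral_laplaceDensity_mul_le hL hβ (f θ x (ψ (x, θ'))) (hFb θ h x θ')
  have e3 : ∫ ω, Real.log (likelihood L β f ψ X Θhat R t (Θ ω) ω
        / predictive L β f ψ P Θ X Θhat R t ω) ∂P
      = ∫ ω, ∫ θ', ∫ θ, (∫ r in Set.Icc 0 L,
        laplaceDensity L β (f θ (X t ω) (ψ (X t ω, θ'))) r * Real.log
        (laplaceDensity L β (f θ (X t ω) (ψ (X t ω, θ'))) r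
          / predictiveDensity L β f π (H ω) (X t ω, ψ (X t ω, θ'), r))) ∂(π (H ω)) ∂(π (H ω)) ∂P := by
    have h1 := hTS.integral_reward hprior hlik hL hβ ht (F := fun θ h x θ' r => Real.log
      (laplaceDensity L β (f θ x (ψ (x, θ'))) r / predictiveDensity L β f π h (x, ψ (x, θ'), r)))
      hFm hFb
    have h2 := hTS.integral_resample ht (F := fun θ h x θ' => ∫ r in Set.Icc 0 L,
      laplaceDensity L β (f θ x (ψ (x, θ'))) r * Real.log
      (laplaceDensity L β (f θ x (ψ (x, θ'))) r / predictiveDensity L β f π h (x, ψ (x, θ'), r)))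
      hDm hDb
    exact h1.trans h2
  have i3 := hTS.integrable_resample ht (F := fun θ h x θ' => ∫ r in Set.Icc 0 L,
      laplaceDensity L β (f θ x (ψ (x, θ'))) r * Real.log
      (laplaceDensity L β (f θ x (ψ (x, θ'))) r / predictiveDensity L β f π h (x, ψ (x, θ'), r)))
      hDm hDb
  have i2 := hTS.integrable_resample ht
    (F := fun θ _ x θ' => laplaceMean L β (f θ x (ψ (x, θ'))))
    (Measurable.laplaceMean (hf.comp (f := fun z : 𝓞 × (Fin t → 𝓧 × 𝓐 × ℝ) × 𝓧 × 𝓞 =>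
      (z.1, z.2.2.1, ψ (z.2.2.1, z.2.2.2))) (by fun_prop)))
    (fun _ _ _ _ => abs_laplaceMean_le hL hβ _)
  have i1 := hTS.integrable_resample ht
    (F := fun _ _ x θ' => laplaceMean L β (f θ' x (ψ (x, θ'))))
    (Measurable.laplaceMean (hf.comp (f := fun z : 𝓞 × (Fin t → 𝓧 × 𝓐 × ℝ) × 𝓧 × 𝓞 =>
      (z.2.2.2, z.2.2.1, ψ (z.2.2.1, z.2.2.2))) (by fun_prop)))
    (fun _ _ _ _ => abs_laplaceMean_le hL hβ _)
  simp only [integral_const, probReal_univ, one_smul] at i1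
  rw [hTS.integral_roundLaw hprior hlik hf hL hβ hψ hint ht,
    hTS.integral_reward_eq hprior hlik hf hL hβ ht, e3, ← integral_sub i1 i2,
    ← integral_const_mul]
  have hc : (Fintype.card 𝓐 : ℝ) * L ^ 2 / (8 * s)
      = ∫ _ω : Ω, (Fintype.card 𝓐 : ℝ) * L ^ 2 / (8 * s) ∂P := by simp
  rw [hc, ← integral_add (integrable_const _) (i3.const_mul s)]
  refine integral_mono (i1.sub i2) ((integrable_const _).add (i3.const_mul s)) fun ω => ?_
  exact thompson_round_le (p := fun a θ r => laplaceDensity L β (f θ (X t ω) a) r) hL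
    (by positivity : 0 < Real.exp (-L / β) / L) (π (H ω)) (ψ := fun θ => ψ (X t ω, θ))
    (by fun_prop)
    (fun a => hlm.comp (f := fun z : 𝓞 × ℝ => (z.1, X t ω, a, z.2)) (by fun_prop))
    (fun a θ r => laplaceDensity_mem hL hβ _ r) (fun a θ => integral_laplaceDensity hL hβ _) hs

end Round

end ContextualBandit

/-! ### The information of all rounds -/

namespace ContextualBandit

section Likelihood

variable {𝓞 𝓧 𝓐 Ω : Type*} {ψ : 𝓧 × 𝓞 → 𝓐} {X : ℕ → Ω → 𝓧} {Θhat : ℕ → Ω → 𝓞} {R : ℕ → Ω → ℝ}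
  {f : 𝓞 → 𝓧 → 𝓐 → ℝ} {L β : ℝ}

lemma likelihood_mem (hL : 0 < L) (hβ : 0 < β) (t : ℕ) (θ : 𝓞) (ω : Ω) :
    likelihood L β f ψ X Θhat R t θ ω
      ∈ Set.Icc (Real.exp (-L / β) / L) (1 / (L * Real.exp (-L / β))) :=
  laplaceDensity_mem hL hβ _ _

lemma likelihood_pos (hL : 0 < L) (hβ : 0 < β) (t : ℕ) (θ : 𝓞) (ω : Ω) :
    0 < likelihood L β f ψ X Θhat R t θ ω :=
  laplaceDensity_pos hL hβ _ _

end Likelihood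

section Information

variable {𝓞 𝓧 𝓐 Ω : Type*} [MeasurableSpace 𝓞] [MeasurableSpace 𝓧] [MeasurableSpace 𝓐]
  [StandardBorelSpace 𝓞] [Nonempty 𝓞] [MeasurableSpace Ω]
  {Φ : ContextualBandit 𝓞 𝓧 𝓐} {T : ℕ} {ψ : 𝓧 × 𝓞 → 𝓐} {P : Measure Ω} [IsProbabilityMeasure P]
  {Θ : Ω → 𝓞} {X : ℕ → Ω → 𝓧} {Θhat : ℕ → Ω → 𝓞} {R : ℕ → Ω → ℝ}
  {O : Set 𝓞} {f : 𝓞 → 𝓧 → 𝓐 → ℝ} {L β : ℝ}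

lemma predictive_pos (hf : Measurable fun p : 𝓞 × 𝓧 × 𝓐 => f p.1 p.2.1 p.2.2)
    (hL : 0 < L) (hβ : 0 < β) (t : ℕ) (ω : Ω) :
    0 < predictive L β f ψ P Θ X Θhat R t ω :=
  predictiveDensity_pos hf hL hβ _ _ _

lemma IsThompsonSampling.aemeasurable_likelihood (hTS : Φ.IsThompsonSampling T ψ P Θ X Θhat R)
    (hf : Measurable fun p : 𝓞 × 𝓧 × 𝓐 => f p.1 p.2.1 p.2.2)
    {σ : 𝓞 → 𝓞} (hσ : Measurable σ) {t : ℕ} (ht : t < T) :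
    AEMeasurable (fun ω => likelihood L β f ψ X Θhat R t (σ (Θ ω)) ω) P := by
  have hψ := hTS.measurable_policy
  have hm : Measurable fun z : 𝓞 × (Fin t → 𝓧 × 𝓐 × ℝ) × 𝓧 × 𝓞 × ℝ =>
      laplaceDensity L β (f (σ z.1) z.2.2.1 (ψ (z.2.2.1, z.2.2.2.1))) z.2.2.2.2 :=
    Measurable.laplaceDensity (hf.comp (f := fun z : 𝓞 × (Fin t → 𝓧 × 𝓐 × ℝ) × 𝓧 × 𝓞 × ℝ =>
      (σ z.1, z.2.2.1, ψ (z.2.2.1, z.2.2.2.1))) (by fun_prop)) (by fun_prop)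
  have h := hm.comp_aemeasurable (hTS.aemeasurable_all ht)
  simp only [likelihood, action]
  exact h

lemma IsThompsonSampling.aemeasurable_predictive (hTS : Φ.IsThompsonSampling T ψ P Θ X Θhat R)
    (hf : Measurable fun p : 𝓞 × 𝓧 × 𝓐 => f p.1 p.2.1 p.2.2) {t : ℕ} (ht : t < T) :
    AEMeasurable (predictive L β f ψ P Θ X Θhat R t) P := by
  have hψ := hTS.measurable_policy
  have hm : Measurable fun z : 𝓞 × (Fin t → 𝓧 × 𝓐 × ℝ) × 𝓧 × 𝓞 × ℝ =>
      predictiveDensity L β f (condDistrib Θ (history ψ X Θhat R t) P) z.2.1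
        (z.2.2.1, ψ (z.2.2.1, z.2.2.2.1), z.2.2.2.2) :=
    (measurable_predictiveDensity hf _).comp
      (f := fun z : 𝓞 × (Fin t → 𝓧 × 𝓐 × ℝ) × 𝓧 × 𝓞 × ℝ =>
        (z.2.1, z.2.2.1, ψ (z.2.2.1, z.2.2.2.1), z.2.2.2.2)) (by fun_prop)
  exact hm.comp_aemeasurable (hTS.aemeasurable_all ht)

lemma IsThompsonSampling.integrable_log_likelihood_div
    (hTS : Φ.IsThompsonSampling T ψ P Θ X Θhat R)
    (hf : Measurable fun p : 𝓞 × 𝓧 × 𝓐 => f p.1 p.2.1 p.2.2) (hL : 0 < L) (hβ : 0 < β)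
    {σ : 𝓞 → 𝓞} (hσ : Measurable σ) {t : ℕ} (ht : t < T) :
    Integrable (fun ω => Real.log (likelihood L β f ψ X Θhat R t (Θ ω) ω
      / likelihood L β f ψ X Θhat R t (σ (Θ ω)) ω)) P := by
  refine Integrable.of_bound ?_ _ (ae_of_all _ fun ω => abs_log_div_le
    (by positivity : 0 < Real.exp (-L / β) / L) (likelihood_mem hL hβ t _ ω)
    (likelihood_mem hL hβ t _ ω))
  exact (((hTS.aemeasurable_likelihood hf measurable_id ht).div
    (hTS.aemeasurable_likelihood hf hσ ht)).log).aestronglyMeasurable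

lemma IsThompsonSampling.integrable_log_likelihood_div_predictive
    (hTS : Φ.IsThompsonSampling T ψ P Θ X Θhat R)
    (hf : Measurable fun p : 𝓞 × 𝓧 × 𝓐 => f p.1 p.2.1 p.2.2) (hL : 0 < L) (hβ : 0 < β)
    {σ : 𝓞 → 𝓞} (hσ : Measurable σ) {t : ℕ} (ht : t < T) :
    Integrable (fun ω => Real.log (likelihood L β f ψ X Θhat R t (σ (Θ ω)) ω
      / predictive L β f ψ P Θ X Θhat R t ω)) P := by
  refine Integrable.of_bound ?_ _ (ae_of_all _ fun ω => abs_log_div_le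
    (by positivity : 0 < Real.exp (-L / β) / L) (likelihood_mem hL hβ t _ ω)
    (predictiveDensity_mem hf hL hβ _ _ _))
  exact (((hTS.aemeasurable_likelihood hf hσ ht).div
    (hTS.aemeasurable_predictive hf ht)).log).aestronglyMeasurable

/-- Replacing the parameter by a nearby one changes the log-likelihood of a round by little, in
expectation under the parameter. -/
lemma IsThompsonSampling.integral_log_likelihood_div_le
    (hTS : Φ.IsThompsonSampling T ψ P Θ X Θhat R)
    (hprior : ∀ᵐ θ ∂Φ.prior, θ ∈ O) (hlik : Φ.HasLaplaceLikelihood O f L β)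
    (hf : Measurable fun p : 𝓞 × 𝓧 × 𝓐 => f p.1 p.2.1 p.2.2) (hL : 0 < L) (hβ : 0 < β)
    {σ : 𝓞 → 𝓞} (hσ : Measurable σ) {t : ℕ} (ht : t < T) {g : Ω → ℝ} (hg : Integrable g P)
    (hle : ∀ᵐ ω ∂P, |f (Θ ω) (X t ω) (action ψ X Θhat t ω)
      - f (σ (Θ ω)) (X t ω) (action ψ X Θhat t ω)| ≤ g ω) :
    ∫ ω, Real.log (likelihood L β f ψ X Θhat R t (Θ ω) ω
      / likelihood L β f ψ X Θhat R t (σ (Θ ω)) ω) ∂P ≤ (∫ ω, g ω ∂P) / β := by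
  have hψ := hTS.measurable_policy
  have hlm := measurable_likelihood hf L β
  have hFm : Measurable fun z : 𝓞 × (Fin t → 𝓧 × 𝓐 × ℝ) × 𝓧 × 𝓞 × ℝ => Real.log
      (laplaceDensity L β (f z.1 z.2.2.1 (ψ (z.2.2.1, z.2.2.2.1))) z.2.2.2.2
        / laplaceDensity L β (f (σ z.1) z.2.2.1 (ψ (z.2.2.1, z.2.2.2.1))) z.2.2.2.2) := by
    refine Measurable.log (Measurable.div ?_ ?_)
    · exact hlm.comp (f := fun z : 𝓞 × (Fin t → 𝓧 × 𝓐 × ℝ) × 𝓧 × 𝓞 × ℝ =>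
        (z.1, z.2.2.1, ψ (z.2.2.1, z.2.2.2.1), z.2.2.2.2)) (by fun_prop)
    · exact hlm.comp (f := fun z : 𝓞 × (Fin t → 𝓧 × 𝓐 × ℝ) × 𝓧 × 𝓞 × ℝ =>
        (σ z.1, z.2.2.1, ψ (z.2.2.1, z.2.2.2.1), z.2.2.2.2)) (by fun_prop)
  have h1 := hTS.integral_reward hprior hlik hL hβ ht (F := fun θ _ x θ' r => Real.log
    (laplaceDensity L β (f θ x (ψ (x, θ'))) r / laplaceDensity L β (f (σ θ) x (ψ (x, θ'))) r))
    hFm (fun _ _ _ _ r => abs_log_laplaceDensity_div_le hL hβ _ r (laplaceDensity_mem hL hβ _ r))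
  refine h1.trans_le ?_
  rw [← integral_div]
  refine integral_mono_of_nonneg (ae_of_all _ fun ω => ?_) (hg.div_const β) ?_
  · exact integral_mul_log_div_nonneg (measurable_laplaceDensity_right L β _)
      (measurable_laplaceDensity_right L β _) (by positivity : 0 < Real.exp (-L / β) / L)
      (laplaceDensity_mem hL hβ _) (laplaceDensity_mem hL hβ _)
      (by rw [integral_laplaceDensity hL hβ, integral_laplaceDensity hL hβ])
  · filter_upwards [hle] with ω hω
    exact (integral_log_laplaceDensity_div_le hL hβ _ _).trans
      (div_le_div_of_nonneg_right hω hβ.le)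

/-- The likelihood ratio of the first `n` rounds is a bounded measurable function of the history. -/
lemma exists_prod_likelihood_div_eq (hf : Measurable fun p : 𝓞 × 𝓧 × 𝓐 => f p.1 p.2.1 p.2.2)
    (hL : 0 < L) (hβ : 0 < β) (ψ : 𝓧 × 𝓞 → 𝓐) (P : Measure Ω) [IsProbabilityMeasure P]
    (Θ : Ω → 𝓞) (X : ℕ → Ω → 𝓧) (Θhat : ℕ → Ω → 𝓞) (R : ℕ → Ω → ℝ) (θ₀ : 𝓞) (n : ℕ) :
    ∃ G : (Fin n → 𝓧 × 𝓐 × ℝ) → ℝ, Measurable G ∧ (∃ B, ∀ h, |G h| ≤ B) ∧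
      ∀ ω, ∏ t ∈ Finset.range n, likelihood L β f ψ X Θhat R t θ₀ ω
        / predictive L β f ψ P Θ X Θhat R t ω = G (history ψ X Θhat R n ω) := by
  induction n with
  | zero => exact ⟨fun _ => 1, measurable_const, ⟨1, by simp⟩, by simp⟩
  | succ n ih =>
    obtain ⟨G, hG, ⟨B, hB⟩, hGeq⟩ := ih
    set π := condDistrib Θ (history ψ X Θhat R n) P with hπ
    set c := Real.exp (-L / β) / L with hc
    set K := 1 / (L * Real.exp (-L / β)) with hK
    have hc0 : 0 < c := by positivity
    have hK0 : 0 < K := by positivity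
    refine ⟨fun h => G (fun s => h s.castSucc) *
      (laplaceDensity L β (f θ₀ (h (Fin.last n)).1 (h (Fin.last n)).2.1) (h (Fin.last n)).2.2
        / predictiveDensity L β f π (fun s => h s.castSucc) (h (Fin.last n))), ?_,
      ⟨B * (K / c), fun h => ?_⟩, fun ω => ?_⟩
    · refine (hG.comp (by fun_prop)).mul (Measurable.div ?_ ?_)
      · exact (measurable_likelihood hf L β).comp (f := fun h : Fin (n + 1) → 𝓧 × 𝓐 × ℝ =>
          (θ₀, h (Fin.last n))) (by fun_prop)
      · exact (measurable_predictiveDensity hf π).comp (f := fun h : Fin (n + 1) → 𝓧 × 𝓐 × ℝ =>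
          ((fun s : Fin n => h s.castSucc), h (Fin.last n))) (by fun_prop)
    · have h1 := laplaceDensity_mem hL hβ (f θ₀ (h (Fin.last n)).1 (h (Fin.last n)).2.1)
        (h (Fin.last n)).2.2
      have h2 := predictiveDensity_mem hf hL hβ π (fun s => h s.castSucc) (h (Fin.last n))
      have h3 := hc0.trans_le h2.1
      rw [abs_mul, abs_div, abs_of_pos h3, abs_of_pos (hc0.trans_le h1.1)]
      exact mul_le_mul (hB _) (div_le_div₀ hK0.le h1.2 hc0 h2.1)
        (div_nonneg (hc0.le.trans h1.1) h3.le) ((abs_nonneg _).trans (hB fun s => h s.castSucc))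
    · rw [Finset.prod_range_succ, hGeq]
      rfl

/-- For every fixed parameter, the likelihood ratio with respect to the predictive densities has
mean one: the predictive density of a round is the conditional density of its reward given the
history, the context and the action. -/
lemma IsThompsonSampling.integral_prod_likelihood_div
    (hTS : Φ.IsThompsonSampling T ψ P Θ X Θhat R)
    (hprior : ∀ᵐ θ ∂Φ.prior, θ ∈ O) (hlik : Φ.HasLaplaceLikelihood O f L β)
    (hf : Measurable fun p : 𝓞 × 𝓧 × 𝓐 => f p.1 p.2.1 p.2.2) (hL : 0 < L) (hβ : 0 < β)
    (θ₀ : 𝓞) {n : ℕ} (hn : n ≤ T) :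
    ∫ ω, ∏ t ∈ Finset.range n, likelihood L β f ψ X Θhat R t θ₀ ω
      / predictive L β f ψ P Θ X Θhat R t ω ∂P = 1 := by
  induction n with
  | zero => simp
  | succ n ih =>
    have hψ := hTS.measurable_policy
    obtain ⟨G, hG, ⟨B, hB⟩, hGeq⟩ := exists_prod_likelihood_div_eq hf hL hβ ψ P Θ X Θhat R θ₀ n
    have ih := ih (by omega)
    rw [← ih]
    have hn' : n < T := hn
    set π := condDistrib Θ (history ψ X Θhat R n) P with hπ
    set c := Real.exp (-L / β) / L with hc
    set K := 1 / (L * Real.exp (-L / β)) with hK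
    have hc0 : 0 < c := by positivity
    have hK0 : 0 < K := by positivity
    have hlm := measurable_likelihood hf L β
    have hqm := measurable_predictiveDensity (L := L) (β := β) hf π
    have hFm : Measurable fun z : 𝓞 × (Fin n → 𝓧 × 𝓐 × ℝ) × 𝓧 × 𝓞 × ℝ => G z.2.1 *
        (laplaceDensity L β (f θ₀ z.2.2.1 (ψ (z.2.2.1, z.2.2.2.1))) z.2.2.2.2
        / predictiveDensity L β f π z.2.1 (z.2.2.1, ψ (z.2.2.1, z.2.2.2.1), z.2.2.2.2)) := by
      refine Measurable.mul (by fun_prop) (Measurable.div ?_ ?_)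
      · exact hlm.comp (f := fun z : 𝓞 × (Fin n → 𝓧 × 𝓐 × ℝ) × 𝓧 × 𝓞 × ℝ =>
          (θ₀, z.2.2.1, ψ (z.2.2.1, z.2.2.2.1), z.2.2.2.2)) (by fun_prop)
      · exact hqm.comp (f := fun z : 𝓞 × (Fin n → 𝓧 × 𝓐 × ℝ) × 𝓧 × 𝓞 × ℝ =>
          (z.2.1, z.2.2.1, ψ (z.2.2.1, z.2.2.2.1), z.2.2.2.2)) (by fun_prop)
    have hFb : ∀ (h : Fin n → 𝓧 × 𝓐 × ℝ) (x : 𝓧) (θ' : 𝓞) (r : ℝ), |G h *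
        (laplaceDensity L β (f θ₀ x (ψ (x, θ'))) r
          / predictiveDensity L β f π h (x, ψ (x, θ'), r))| ≤ B * (K / c) := by
      intro h x θ' r
      have h1 := laplaceDensity_mem hL hβ (f θ₀ x (ψ (x, θ'))) r
      have h2 := predictiveDensity_mem hf hL hβ π h (x, ψ (x, θ'), r)
      have h3 := hc0.trans_le h2.1
      rw [abs_mul, abs_div, abs_of_pos h3, abs_of_pos (hc0.trans_le h1.1)]
      exact mul_le_mul (hB _) (div_le_div₀ hK0.le h1.2 hc0 h2.1)
        (div_nonneg (hc0.le.trans h1.1) h3.le) ((abs_nonneg _).trans (hB h))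
    have hDm : Measurable fun z : 𝓞 × (Fin n → 𝓧 × 𝓐 × ℝ) × 𝓧 × 𝓞 => ∫ r in Set.Icc 0 L,
        laplaceDensity L β (f z.1 z.2.2.1 (ψ (z.2.2.1, z.2.2.2))) r * (G z.2.1 *
        (laplaceDensity L β (f θ₀ z.2.2.1 (ψ (z.2.2.1, z.2.2.2))) r
          / predictiveDensity L β f π z.2.1 (z.2.2.1, ψ (z.2.2.1, z.2.2.2), r))) := by
      have := StronglyMeasurable.integral_prod_right' (ν := volume.restrict (Set.Icc 0 L))
        (f := fun w : (𝓞 × (Fin n → 𝓧 × 𝓐 × ℝ) × 𝓧 × 𝓞) × ℝ =>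
          laplaceDensity L β (f w.1.1 w.1.2.2.1 (ψ (w.1.2.2.1, w.1.2.2.2))) w.2 * (G w.1.2.1 *
          (laplaceDensity L β (f θ₀ w.1.2.2.1 (ψ (w.1.2.2.1, w.1.2.2.2))) w.2
          / predictiveDensity L β f π w.1.2.1 (w.1.2.2.1, ψ (w.1.2.2.1, w.1.2.2.2), w.2))))
        (Measurable.mul
          (hlm.comp (f := fun w : (𝓞 × (Fin n → 𝓧 × 𝓐 × ℝ) × 𝓧 × 𝓞) × ℝ =>
            (w.1.1, w.1.2.2.1, ψ (w.1.2.2.1, w.1.2.2.2), w.2)) (by fun_prop))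
          (hFm.comp (f := fun w : (𝓞 × (Fin n → 𝓧 × 𝓐 × ℝ) × 𝓧 × 𝓞) × ℝ =>
            (w.1.1, w.1.2.1, w.1.2.2.1, w.1.2.2.2, w.2)) (by fun_prop))).stronglyMeasurable
      exact this.measurable
    have h1 := hTS.integral_reward hprior hlik hL hβ hn' (F := fun _ h x θ' r => G h *
        (laplaceDensity L β (f θ₀ x (ψ (x, θ'))) r
          / predictiveDensity L β f π h (x, ψ (x, θ'), r))) hFm (fun _ => hFb)
    have h2 := hTS.integral_resample hn' (F := fun θ h x θ' => ∫ r in Set.Icc 0 L,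
        laplaceDensity L β (f θ x (ψ (x, θ'))) r * (G h *
        (laplaceDensity L β (f θ₀ x (ψ (x, θ'))) r
          / predictiveDensity L β f π h (x, ψ (x, θ'), r)))) hDm
      (fun θ h x θ' => abs_setIntegral_laplaceDensity_mul_le hL hβ _ (hFb h x θ'))
    calc ∫ ω, ∏ t ∈ Finset.range (n + 1), likelihood L β f ψ X Θhat R t θ₀ ω
          / predictive L β f ψ P Θ X Θhat R t ω ∂P
        = ∫ ω, G (history ψ X Θhat R n ω) *
          (laplaceDensity L β (f θ₀ (X n ω) (ψ (X n ω, Θhat n ω))) (R n ω)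
            / predictiveDensity L β f π (history ψ X Θhat R n ω)
              (X n ω, ψ (X n ω, Θhat n ω), R n ω)) ∂P := by
          refine integral_congr_ae (ae_of_all _ fun ω => ?_)
          simp only
          rw [Finset.prod_range_succ, hGeq]
          rfl
      _ = _ := h1
      _ = _ := h2
      _ = ∫ ω, G (history ψ X Θhat R n ω) ∂P := by
          refine integral_congr_ae (ae_of_all _ fun ω => ?_)
          simp only
          rw [integral_congr_ae (ae_of_all _ fun θ' =>
            integral_integral_mul_div_predictiveDensity hf hL hβ π _ (X n ω) (ψ (X n ω, θ')) _ _)]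
          simp
      _ = _ := integral_congr_ae (ae_of_all _ fun ω => (hGeq ω).symm)

/-- The information that the rewards of all rounds carry about the parameter, bounded by the
logarithm of the size of a finite set of parameters `e 0, …, e N` and the error of replacing the
parameter `Θ` by its approximation `σ Θ` in this set. -/
lemma IsThompsonSampling.sum_information_le
    (hTS : Φ.IsThompsonSampling T ψ P Θ X Θhat R)
    (hprior : ∀ᵐ θ ∂Φ.prior, θ ∈ O) (hlik : Φ.HasLaplaceLikelihood O f L β)
    (hf : Measurable fun p : 𝓞 × 𝓧 × 𝓐 => f p.1 p.2.1 p.2.2) (hL : 0 < L) (hβ : 0 < β)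
    {σ : 𝓞 → 𝓞} (hσ : Measurable σ) {N : ℕ} {e : ℕ → 𝓞} (hσe : ∀ θ, ∃ k ≤ N, σ θ = e k)
    {g : ℕ → Ω → ℝ} (hg : ∀ t < T, Integrable (g t) P)
    (hle : ∀ t < T, ∀ᵐ ω ∂P, |f (Θ ω) (X t ω) (action ψ X Θhat t ω)
      - f (σ (Θ ω)) (X t ω) (action ψ X Θhat t ω)| ≤ g t ω) :
    ∑ t ∈ Finset.range T, ∫ ω, Real.log (likelihood L β f ψ X Θhat R t (Θ ω) ω
        / predictive L β f ψ P Θ X Θhat R t ω) ∂P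
      ≤ Real.log (N + 1) + (∑ t ∈ Finset.range T, ∫ ω, g t ω ∂P) / β := by
  have hN : (0 : ℝ) < N + 1 := by positivity
  set l : ℕ → 𝓞 → Ω → ℝ := likelihood L β f ψ X Θhat R with hl
  set q : ℕ → Ω → ℝ := predictive L β f ψ P Θ X Θhat R with hq
  have hl0 (t θ ω) : 0 < l t θ ω := likelihood_pos hL hβ t θ ω
  have hq0 (t ω) : 0 < q t ω := predictive_pos hf hL hβ t ω
  have i1 : ∀ t < T, Integrable (fun ω => Real.log (l t (Θ ω) ω / l t (σ (Θ ω)) ω)) P :=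
    fun t ht => hTS.integrable_log_likelihood_div hf hL hβ hσ ht
  have i2 : ∀ t < T, Integrable (fun ω => Real.log (l t (σ (Θ ω)) ω / q t ω)) P :=
    fun t ht => hTS.integrable_log_likelihood_div_predictive hf hL hβ hσ ht
  have hsplit : ∀ t ∈ Finset.range T, ∫ ω, Real.log (l t (Θ ω) ω / q t ω) ∂P
      = (∫ ω, Real.log (l t (σ (Θ ω)) ω / q t ω) ∂P)
        + ∫ ω, Real.log (l t (Θ ω) ω / l t (σ (Θ ω)) ω) ∂P := by
    intro t ht
    rw [Finset.mem_range] at ht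
    rw [← integral_add (i2 t ht) (i1 t ht)]
    refine integral_congr_ae (ae_of_all _ fun ω => ?_)
    simp only
    rw [Real.log_div (hl0 _ _ _).ne' (hq0 _ _).ne', Real.log_div (hl0 _ _ _).ne' (hq0 _ _).ne',
      Real.log_div (hl0 _ _ _).ne' (hl0 _ _ _).ne']
    ring
  rw [Finset.sum_congr rfl hsplit, Finset.sum_add_distrib]
  refine add_le_add ?_ ?_
  · -- the likelihood ratio of `σ Θ` is one of the `N + 1` summands of `Y`, and `Y` has mean `N + 1`
    set W : 𝓞 → Ω → ℝ := fun θ ω => ∏ t ∈ Finset.range T, l t θ ω / q t ω with hW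
    have hW0 (θ ω) : 0 < W θ ω := Finset.prod_pos fun t _ => div_pos (hl0 _ _ _) (hq0 _ _)
    set Y : Ω → ℝ := fun ω => ∑ k ∈ Finset.range (N + 1), W (e k) ω with hY
    have hW1 (θ) : ∫ ω, W θ ω ∂P = 1 :=
      hTS.integral_prod_likelihood_div hprior hlik hf hL hβ θ le_rfl
    have hWi (θ) : Integrable (W θ) P :=
      Integrable.of_integral_ne_zero (by rw [hW1]; exact one_ne_zero)
    have hYi : Integrable Y P := integrable_finsetSum _ fun k _ => hWi (e k)
    have hY1 : ∫ ω, Y ω ∂P = N + 1 := by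
      rw [integral_finsetSum _ fun k _ => hWi (e k)]
      simp [hW1]
    rw [← integral_finsetSum _ fun t ht => i2 t (Finset.mem_range.1 ht)]
    have hpt : ∀ ω, ∑ t ∈ Finset.range T, Real.log (l t (σ (Θ ω)) ω / q t ω)
        ≤ Y ω / (N + 1) - 1 + Real.log (N + 1) := by
      intro ω
      obtain ⟨k, hk, hke⟩ := hσe (Θ ω)
      have hsum : ∑ t ∈ Finset.range T, Real.log (l t (σ (Θ ω)) ω / q t ω)
          = Real.log (W (σ (Θ ω)) ω) :=
        (Real.log_prod fun t _ => (div_pos (hl0 _ _ _) (hq0 _ _)).ne').symm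
      have hWY : W (σ (Θ ω)) ω ≤ Y ω := by
        rw [hke]
        exact Finset.single_le_sum (f := fun k => W (e k) ω) (fun k _ => (hW0 (e k) ω).le)
          (Finset.mem_range.2 (Nat.lt_succ_of_le hk))
      have hY0 : 0 < Y ω := (hW0 _ _).trans_le hWY
      have h1 := Real.log_le_sub_one_of_pos (div_pos hY0 hN)
      rw [Real.log_div hY0.ne' hN.ne'] at h1
      have h2 := Real.log_le_log (hW0 _ _) hWY
      rw [hsum]
      linarith
    have hi : Integrable (fun ω => Y ω / (N + 1) - 1) P :=
      (hYi.div_const _).sub (integrable_const _)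
    refine (integral_mono (integrable_finsetSum _ fun t ht => i2 t (Finset.mem_range.1 ht))
      (hi.add (integrable_const _)) hpt).trans_eq ?_
    simp only [Pi.add_apply]
    rw [integral_add hi (integrable_const _), integral_sub (hYi.div_const _) (integrable_const _),
      integral_div, hY1, div_self hN.ne']
    simp
  · rw [Finset.sum_div]
    exact Finset.sum_le_sum fun t ht => hTS.integral_log_likelihood_div_le hprior hlik hf hL hβ hσ
      (Finset.mem_range.1 ht) (hg t (Finset.mem_range.1 ht)) (hle t (Finset.mem_range.1 ht))

end Information

end ContextualBandit

/-! ### The regret bound -/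

namespace ContextualBandit

section Regret

variable {𝓞 𝓧 𝓐 Ω : Type*} [MeasurableSpace 𝓞] [MeasurableSpace 𝓧] [MeasurableSpace 𝓐]
  [StandardBorelSpace 𝓞] [Nonempty 𝓞] [MeasurableSpace Ω] [Fintype 𝓐] [DiscreteMeasurableSpace 𝓐]
  {Φ : ContextualBandit 𝓞 𝓧 𝓐} {T : ℕ} {ψ : 𝓧 × 𝓞 → 𝓐} {P : Measure Ω} [IsProbabilityMeasure P]
  {Θ : Ω → 𝓞} {X : ℕ → Ω → 𝓧} {Θhat : ℕ → Ω → 𝓞} {R : ℕ → Ω → ℝ}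
  {O : Set 𝓞} {f : 𝓞 → 𝓧 → 𝓐 → ℝ} {L β : ℝ}

/-- The regret of Thompson Sampling in terms of the total information `I` about the parameter, with
a free parameter `s` that balances the two terms. -/
lemma IsThompsonSampling.regret_le (hTS : Φ.IsThompsonSampling T ψ P Θ X Θhat R)
    (hopt : Φ.IsOptimalPolicy T ψ)
    (hprior : ∀ᵐ θ ∂Φ.prior, θ ∈ O) (hlik : Φ.HasLaplaceLikelihood O f L β)
    (hf : Measurable fun p : 𝓞 × 𝓧 × 𝓐 => f p.1 p.2.1 p.2.2) (hL : 0 < L) (hβ : 0 < β)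
    {I : ℝ} (hI : ∑ t ∈ Finset.range T, ∫ ω, Real.log (likelihood L β f ψ X Θhat R t (Θ ω) ω
        / predictive L β f ψ P Θ X Θhat R t ω) ∂P ≤ I) {s : ℝ} (hs : 0 < s) :
    Φ.regret T P R ≤ T * (Fintype.card 𝓐 * L ^ 2 / 8) / s + s * I := by
  obtain ⟨hψ, hint, hcum⟩ := hopt
  have hR : ∀ t ∈ Finset.range T, Integrable (R t) P := by
    intro t ht
    rw [Finset.mem_range] at ht
    exact Integrable.of_mem_Icc 0 L (hTS.aemeasurable_all ht).snd.snd.snd.snd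
      (hTS.ae_reward_mem hprior hlik hL hβ ht)
  rw [regret, ← hcum, cumulativeReward, integral_finsetSum _ hR, ← Finset.sum_sub_distrib]
  calc ∑ t ∈ Finset.range T, ((∫ q, q.2 ∂(Φ.roundLaw ψ hψ)) - ∫ ω, R t ω ∂P)
      ≤ ∑ t ∈ Finset.range T, (Fintype.card 𝓐 * L ^ 2 / (8 * s) + s * ∫ ω, Real.log
        (likelihood L β f ψ X Θhat R t (Θ ω) ω / predictive L β f ψ P Θ X Θhat R t ω) ∂P) :=
        Finset.sum_le_sum fun t ht => hTS.round_regret_le hprior hlik hf hL hβ hψ hint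
          (Finset.mem_range.1 ht) hs
    _ = T * (Fintype.card 𝓐 * L ^ 2 / 8) / s + s * ∑ t ∈ Finset.range T, ∫ ω, Real.log
        (likelihood L β f ψ X Θhat R t (Θ ω) ω / predictive L β f ψ P Θ X Θhat R t ω) ∂P := by
        rw [Finset.sum_add_distrib, ← Finset.mul_sum, Finset.sum_const, Finset.card_range,
          nsmul_eq_mul]
        field_simp
    _ ≤ _ := by gcongr

end Regret

end ContextualBandit

theorem corollary2
    (d T : ℕ) (hd : 0 < d) (S L β : ℝ) (hL : 0 < L) (hβ : 0 < β)
    -- the parameter set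
    (O : Set (EuclideanSpace ℝ (Fin d))) (hO : Bornology.IsBounded O) (hOS : Metric.diam O ≤ S)
    -- the bandit problem, with finitely many actions
    {𝓧 𝓐 : Type*} [MeasurableSpace 𝓧] [Fintype 𝓐] [MeasurableSpace 𝓐]
    [DiscreteMeasurableSpace 𝓐]
    (Φ : ContextualBandit (EuclideanSpace ℝ (Fin d)) 𝓧 𝓐)
    (hprior : ∀ᵐ θ ∂Φ.prior, θ ∈ O)
    (f : EuclideanSpace ℝ (Fin d) → 𝓧 → 𝓐 → ℝ)
    (hf : Measurable fun p : EuclideanSpace ℝ (Fin d) × 𝓧 × 𝓐 => f p.1 p.2.1 p.2.2)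
    (hlik : Φ.HasLaplaceLikelihood O f L β)
    -- an optimal policy, and a run of Thompson Sampling with it
    (ψ : 𝓧 × EuclideanSpace ℝ (Fin d) → 𝓐) (hψ : Φ.IsOptimalPolicy T ψ)
    {Ω : Type*} [MeasurableSpace Ω] (P : MeasureTheory.Measure Ω)
    [MeasureTheory.IsProbabilityMeasure P]
    (Θ : Ω → EuclideanSpace ℝ (Fin d)) (X : ℕ → Ω → 𝓧)
    (Θhat : ℕ → Ω → EuclideanSpace ℝ (Fin d)) (R : ℕ → Ω → ℝ)
    (hTS : Φ.IsThompsonSampling T ψ P Θ X Θhat R)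
    -- `f_θ(X, A)` is a Lipschitz process in `θ`, with random constant `C(X, A)`
    (C : 𝓧 → 𝓐 → ℝ) (hC0 : ∀ x a, 0 ≤ C x a)
    (hCint : ∀ t < T, MeasureTheory.Integrable
      (fun ω => C (X t ω) (ContextualBandit.action ψ X Θhat t ω)) P)
    (hLip : ∀ t < T, ∀ᵐ ω ∂P, ∀ θ ∈ O, ∀ θ' ∈ O,
      |f θ (X t ω) (ContextualBandit.action ψ X Θhat t ω)
          - f θ' (X t ω) (ContextualBandit.action ψ X Θhat t ω)|
        ≤ C (X t ω) (ContextualBandit.action ψ X Θhat t ω) * dist θ θ')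
    -- the scale `dβ / (E[C] T)` is at most `3S`
    (hscale : (d : ℝ) * β ≤ 3 * S * ContextualBandit.expectedLipschitz P T C X
      (ContextualBandit.action ψ X Θhat) * T) :
    Φ.regret T P R ≤
      Real.sqrt (L ^ 2 * (Fintype.card 𝓐 : ℝ) * T * d / 2 *
        (1 + Real.log (3 * S * ContextualBandit.expectedLipschitz P T C X
          (ContextualBandit.action ψ X Θhat) * T / (d * β)))) := by
  set A := ContextualBandit.action ψ X Θhat with hA
  set c := ContextualBandit.expectedLipschitz P T C X A with hc
  have hd0 : (0 : ℝ) < d := Nat.cast_pos.2 hd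
  have hdβ : 0 < (d : ℝ) * β := mul_pos hd0 hβ
  have hS0 : 0 ≤ S := Metric.diam_nonneg.trans hOS
  have hT : (0 : ℝ) < T := by
    rcases (Nat.cast_nonneg T : (0 : ℝ) ≤ T).eq_or_lt with h | h
    · rw [← h, mul_zero] at hscale; linarith
    · exact h
  have hcT : ∑ t ∈ Finset.range T, ∫ ω, C (X t ω) (A t ω) ∂P = c * T := by
    rw [hc, ContextualBandit.expectedLipschitz, div_mul_cancel₀ _ hT.ne']
  have hcT0 : 0 < c * T := by
    have h : 0 ≤ c * T := by
      rw [← hcT]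
      exact Finset.sum_nonneg fun t _ => integral_nonneg fun ω => hC0 _ _
    rcases h.eq_or_lt with h | h
    · rw [mul_assoc, ← h, mul_zero] at hscale; linarith
    · exact h
  have hc0 : c ≠ 0 := left_ne_zero_of_mul hcT0.ne'
  -- the radius of the net
  set ε := d * β / (c * T) with hε
  have hε0 : 0 < ε := div_pos hdβ hcT0
  have hεS : ε ≤ 3 * S := by
    rw [hε, div_le_iff₀ hcT0]; linarith
  have hne : O.Nonempty := hprior.exists
  obtain ⟨N, e, heO, hcov, hN⟩ := exists_net_of_diam_le hε0 hεS hne hO hOS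
  set σ := SimpleFunc.nearestPt e N with hσ
  have hσe : ∀ θ, ∃ k ≤ N, σ θ = e k := fun θ =>
    ⟨SimpleFunc.nearestPtInd e N θ, SimpleFunc.nearestPtInd_le e N θ, rfl⟩
  have hσd : ∀ θ ∈ O, dist θ (σ θ) ≤ ε := by
    intro θ hθ
    obtain ⟨k, hk, hkθ⟩ := hcov θ hθ
    have h := SimpleFunc.edist_nearestPt_le e θ hk
    rw [edist_dist, edist_dist, ENNReal.ofReal_le_ofReal_iff dist_nonneg] at h
    rw [dist_comm]
    exact h.trans hkθ
  have hinfo := hTS.sum_information_le hprior hlik hf hL hβ σ.measurable hσe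
    (g := fun t ω => C (X t ω) (A t ω) * ε) (fun t ht => (hCint t ht).mul_const ε) (by
      intro t ht
      filter_upwards [hLip t ht, hTS.ae_mem hprior] with ω hω hΘ
      obtain ⟨k, -, hk⟩ := hσe (Θ ω)
      refine (hω _ hΘ (σ (Θ ω)) (hk ▸ heO k)).trans ?_
      exact mul_le_mul_of_nonneg_left (hσd _ hΘ) (hC0 _ _))
  have hx : 3 * S * c * T / (d * β) = 3 * S / ε := by
    rw [hε]; field_simp
  set J := (d : ℝ) * (1 + Real.log (3 * S * c * T / (d * β))) with hJ
  have hlog0 : 0 ≤ Real.log (3 * S * c * T / (d * β)) :=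
    Real.log_nonneg ((one_le_div hdβ).2 hscale)
  have hJ0 : 0 < J := by positivity
  have hI : Real.log (N + 1)
      + (∑ t ∈ Finset.range T, ∫ ω, C (X t ω) (A t ω) * ε ∂P) / β ≤ J := by
    simp_rw [integral_mul_const]
    rw [← Finset.sum_mul, hcT]
    have h1 : c * T * ε / β = d := by rw [hε]; field_simp
    have h2 : Real.log (N + 1) ≤ d * Real.log (3 * S * c * T / (d * β)) := by
      rw [hx, ← Real.log_pow]
      exact Real.log_le_log (by positivity) hN
    rw [h1, hJ]
    linarith
  have hcard : (0 : ℝ) < Fintype.card 𝓐 := by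
    obtain ⟨ω⟩ : Nonempty Ω := P.nonempty_of_neZero
    have : Nonempty 𝓐 := ⟨A 0 ω⟩
    exact Nat.cast_pos.2 Fintype.card_pos
  -- the two terms of the regret bound balance at `s = √(a / J)`
  set a := T * ((Fintype.card 𝓐 : ℝ) * L ^ 2 / 8) with ha
  have ha0 : 0 < a := by positivity
  have hreg := hTS.regret_le hψ hprior hlik hf hL hβ (hinfo.trans hI)
    (s := Real.sqrt a / Real.sqrt J) (by positivity)
  refine hreg.trans_eq ?_
  rw [← ha]
  have e1 : a / (Real.sqrt a / Real.sqrt J) + Real.sqrt a / Real.sqrt J * J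
      = 2 * (Real.sqrt a * Real.sqrt J) := by
    have h1 := Real.sq_sqrt ha0.le
    have h2 := Real.sq_sqrt hJ0.le
    have h3 : 0 < Real.sqrt a := Real.sqrt_pos.2 ha0
    have h4 : 0 < Real.sqrt J := Real.sqrt_pos.2 hJ0
    field_simp
    rw [h1, h2]
    ring
  rw [e1, ← Real.sqrt_mul ha0.le]
  symm
  rw [Real.sqrt_eq_iff_mul_self_eq (by positivity) (by positivity), mul_mul_mul_comm,
    Real.mul_self_sqrt (by positivity), ha, hJ]
  ring
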